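/- Let $l,n_P,n_A\ge 1$ be integers and let $d_P,d_A\ge 0$ be integers. An instance is a triple of problem features in $\mathbb{R}^{d_P}$, predefined algorithm features in $\mathbb{R}^{d_A}$, and a label $y\in\{-1,1\}$; the model input $x\in\mathbb{R}^{d_P+d_A}$ is the concatenation of the two feature vectors. Let $D$ be a probability distribution on instances, and let the training sample $\mathcal S$ consist of $|\mathcal S|=|\mathcal S_{\mathcal P}|\cdot|\mathcal S_{\mathcal A}|$ instances $(x_i,y_i)$ drawn independently from $D$, where $|\mathcal S_{\mathcal P}|=n_P$ and $|\mathcal S_{\mathcal A}|=n_A$. For given bounds $R_1,\dots,R_l$, let $\mathcal F$ be the class of all real-valued networks with $l$ layers $$\mathbf f(x)=W^{(l)}\phi^{(l-1)}\bigl(W^{(l-1)}\phi^{(l-2)}(\cdots\phi^{(1)}(W^{(1)}x))\bigr)$$ of arbitrary hidden widths, with Frobenius norms $\|W^{(i)}\|_F\le R_i$ and with coordinatewise activation functions $\phi^{(i)}$ that are $1$-Lipschitz and positive-homogeneous. For $\gamma>0$ and $\mathbf f\in\mathcal F$ put $$Error_{\mathcal T}(\mathbf f)=P_{(x,y)\sim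 D}\bigl(y\,\mathbf f(x)<0\bigr),\qquad Error_{\mathcal S}(\mathbf f)=\frac{|\{i: y_i\mathbf f(x_i)<\gamma\}|}{|\mathcal S|},$$ the test error and the empirical error at margin $\gamma$. Put $\Gamma_{\mathbf f}=\prod_{i=1}^l R_i$, $\Gamma_{\mathcal S}=\max_{x_j\in\mathcal S}\|x_j\|^2$ (Euclidean norm), and $$c_1=\sqrt{\log\bigl(\log_2\tfrac4\gamma\bigr)}+\sqrt{\log\tfrac1\delta},$$ where for $\gamma>2$ the first root is read as $0$. There are absolute constants $K_1,K_2>0$ such that the following holds for all such $l,n_P,n_A,d_P,d_A$, $(R_i)$ and $D$ and all $\delta\in(0,1)$. Assume $\Gamma_{\mathbf f}>1$ and that $\sqrt{|\mathcal S_{\mathcal P}|\cdot|\mathcal S_{\mathcal A}|}$ dominates $(\log 2)\,l$, for which $\sqrt{|\mathcal S_{\mathcal P}|\cdot|\mathcal S_{\mathcal A}|}\ge(\log 2)\,l$ suffices. Then with probability at least $1-\delta$ over the sample (that is, the exceptional event has outer probability at most $\delta$): if $\Gamma_{\mathcal S}>1$, then simultaneously for all margins $\gamma>0$ and all $\mathbf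 f\in\mathcal F$, $$Error_{\mathcal T}(\mathbf f)\le Error_{\mathcal S}(\mathbf f)+K_1\,\frac{\Gamma_{\mathbf f}\,\Gamma_{\mathcal S}^{3/4}}{|\mathcal S_{\mathcal P}|^{1/4}|\mathcal S_{\mathcal A}|^{1/4}\,\gamma}+K_2\,\frac{c_1}{\sqrt{|\mathcal S_{\mathcal P}|\cdot|\mathcal S_{\mathcal A}|}}.$$ -/

import Mathlib

open MeasureTheory

noncomputable section

namespace AlgSel

section Frobenius

open scoped Matrix.Norms.Frobenius

/-- The Frobenius norm of a real matrix. -/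
def frobNorm {m n : Type} [Fintype m] [Fintype n] (W : Matrix m n ℝ) : ℝ := ‖W‖

end Frobenius

/-- A 1-Lipschitz, positive-homogeneous scalar activation function. -/
structure IsActivation (φ : ℝ → ℝ) : Prop where
  lipschitz : LipschitzWith 1 φ
  posHomogeneous : ∀ c t : ℝ, 0 ≤ c → φ (c * t) = c * φ t

/-- `Network ι l m` is the type of feed-forward networks with `l` layers, with input coordinates
indexed by `ι` and `m` outputs. The hidden widths are arbitrary. A network is given by its weight
matrices `W⁽¹⁾, …, W⁽ˡ⁾` and its activation functions `φ⁽¹⁾, …, φ⁽ˡ⁻¹⁾`. -/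
inductive Network (ι : Type) : ℕ → ℕ → Type
  | first {m : ℕ} (W : Matrix (Fin m) ι ℝ) : Network ι 1 m
  | layer {l k m : ℕ} (N : Network ι l k) (φ : ℝ → ℝ) (W : Matrix (Fin m) (Fin k) ℝ) :
      Network ι (l + 1) m

namespace Network

variable {ι : Type} [Fintype ι]

/-- The function computed by a network,
`W⁽ˡ⁾ φ⁽ˡ⁻¹⁾(W⁽ˡ⁻¹⁾ φ⁽ˡ⁻²⁾(⋯ φ⁽¹⁾(W⁽¹⁾ x)))`, with the activations applied coordinatewise. -/
def eval : {l m : ℕ} → Network ι l m → EuclideanSpace ℝ ι → Fin m → ℝ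
  | _, _, .first W, x => W.mulVec x.ofLp
  | _, _, .layer N φ W, x => W.mulVec (fun j => φ (N.eval x j))

/-- The weight matrix of layer `i` has Frobenius norm at most `R i` (layers are numbered from 1),
and every activation function is 1-Lipschitz and positive-homogeneous. -/
def Admissible (R : ℕ → ℝ) : {l m : ℕ} → Network ι l m → Prop
  | _, _, .first W => frobNorm W ≤ R 1
  | l + 1, _, .layer N φ W => N.Admissible R ∧ IsActivation φ ∧ frobNorm W ≤ R (l + 1)

end Network

/-- The class of all real-valued admissible networks with `l` layers. -/
def networkClass (ι : Type) [Fintype ι] (l : ℕ) (R : ℕ → ℝ) : Set (EuclideanSpace ℝ ι → ℝ) :=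
  {f | ∃ N : Network ι l 1, N.Admissible R ∧ ∀ x, f x = N.eval x 0}

/-- A labelled instance: problem features, predefined algorithm features, and a label. -/
abbrev LabeledInstance (dP dA : ℕ) : Type :=
  EuclideanSpace ℝ (Fin dP) × EuclideanSpace ℝ (Fin dA) × ℝ

/-- The model input: problem features and algorithm features, concatenated. -/
def input {dP dA : ℕ} (z : LabeledInstance dP dA) : EuclideanSpace ℝ (Fin dP ⊕ Fin dA) :=
  WithLp.toLp 2 (Sum.elim z.1.ofLp z.2.1.ofLp)

/-- The label of an instance. -/
def label {dP dA : ℕ} (z : LabeledInstance dP dA) : ℝ := z.2.2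

/-- The test error `P(y f(x) < 0)` of the selector `f` on a fresh instance drawn from `D`. -/
def testError {dP dA : ℕ} (D : Measure (LabeledInstance dP dA))
    (f : EuclideanSpace ℝ (Fin dP ⊕ Fin dA) → ℝ) : ℝ :=
  D.real {z | label z * f (input z) < 0}

/-- The empirical error at margin `γ`: the fraction of training instances with `y f(x) < γ`. -/
def empiricalError {dP dA nP nA : ℕ} (S : Fin nP × Fin nA → LabeledInstance dP dA) (γ : ℝ)
    (f : EuclideanSpace ℝ (Fin dP ⊕ Fin dA) → ℝ) : ℝ :=
  (Set.ncard {i | label (S i) * f (input (S i)) < γ} : ℝ) / ((nP : ℝ) * (nA : ℝ))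

/-- `Γ_f = ∏_{i=1}^l R_i`. -/
def gammaF (l : ℕ) (R : ℕ → ℝ) : ℝ := ∏ i ∈ Finset.Icc 1 l, R i

/-- `Γ_S = max_{x ∈ S} ‖x‖²`, with the Euclidean norm. -/
def gammaS {dP dA nP nA : ℕ} (S : Fin nP × Fin nA → LabeledInstance dP dA) : ℝ :=
  ⨆ i, ‖input (S i)‖ ^ 2

/-- `c₁ = √(log (log₂ (4 / γ))) + √(log (1 / δ))`. The first root is a real number only for
`γ ≤ 2`; the `max` leaves it unchanged there and makes it zero for `γ > 2`. -/
def c₁ (γ δ : ℝ) : ℝ :=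
  √(Real.log (max 1 (Real.logb 2 (4 / γ)))) + √(Real.log (1 / δ))

end AlgSel

end

/-! By homogeneity a network sees an input only through its norm and its direction, so the ramp
loss can be studied on inputs scaled to the unit sphere, at margins `ρ = Γ_f / 2 ^ j`.

The Rademacher complexity of the class is bounded inside an exponential moment. A layer is peeled
off as follows: a positive-homogeneous `1`-Lipschitz activation is `α t + β |t|` with
`|α| + |β| ≤ 1`, and a network is a combination of activated networks of the previous depth with
coefficients of total absolute value at most `R l` (normalize the rows of the weight matrix, then
use Cauchy–Schwarz). The `|t|` part is removed by contraction. Each layer thus costs a factor `3`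
whatever its width, which the logarithm turns into `l log 3`, and a linear network remains, whose
moments are bounded through `cosh (t ‖v + x‖) + cosh (t ‖v - x‖) ≤ 2 cosh (t ‖v‖) cosh (t ‖x‖)`.
The result is `2 Γ_f √(l n)` for `n` points of norm at most `1`.

Symmetrization and the bounded difference inequality turn this into a uniform deviation bound for
each `ρ`, and a union over `j` with deviation `2 ^ j √(l / n) + √(log (1 / δ) / n)` costs a
geometric series. Given the sample, `γ` is compared with the dyadic margin for which
`ρ √Γ_S < γ ≤ 2 ρ √Γ_S`; if `γ > Γ_f √Γ_S` then every training instance violates the margin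
and the empirical error is `1`. Measurability of the exceptional event is avoided by passing to a
countable subclass dense for uniform convergence on compact sets. -/

noncomputable section

namespace AlgSel

open Real Filter Topology
open scoped BigOperators NNReal

section Convexity

theorem add_sub_le_add_sub_of_convexOn {s : Set ℝ} {φ : ℝ → ℝ} (hφ : ConvexOn ℝ s φ) {p q r : ℝ}
    (hq : |q| ≤ r) (hl : p - r ∈ s) (hu : p + r ∈ s) :
    φ (p + q) + φ (p - q) ≤ φ (p - r) + φ (p + r) := by
  obtain ⟨hrq, hqr⟩ := abs_le.1 hq
  have hmem : p + q ∈ segment ℝ (p - r) (p + r) := by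
    rw [segment_eq_Icc (by linarith)]
    constructor <;> linarith
  obtain ⟨a, b, ha, hb, hab, h⟩ := hmem
  have h' : b • (p - r) + a • (p + r) = p - q := by
    simp only [smul_eq_mul] at h ⊢
    linear_combination (2 * p) * hab - h
  have h₁ := hφ.2 hl hu ha hb hab
  have h₂ := hφ.2 hl hu hb ha (by linarith)
  rw [h] at h₁
  rw [h'] at h₂
  simp only [smul_eq_mul] at h₁ h₂
  linear_combination h₁ + h₂ + (φ (p - r) + φ (p + r)) * hab

theorem exp_add_exp_le_exp_add_exp {p q p' q' : ℝ} (hs : p + q ≤ p' + q')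
    (hp : p ≤ max p' q') (hq : q ≤ max p' q') : exp p + exp q ≤ exp p' + exp q' := by
  wlog h : q' ≤ p' generalizing p' q'
  · rw [add_comm (exp p')]
    exact this (by linarith) (by rwa [max_comm]) (by rwa [max_comm]) (by linarith)
  rw [max_eq_left h] at hp hq
  set m := (p' + q') / 2 with hm
  set r := (p' - q') / 2 with hr
  have hspread {x : ℝ} (hx : |x - m| ≤ r) : exp x + exp (2 * m - x) ≤ exp p' + exp q' := by
    have := add_sub_le_add_sub_of_convexOn convexOn_exp hx (Set.mem_univ (m - r))
      (Set.mem_univ (m + r))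
    rw [show m + (x - m) = x by ring, show m - (x - m) = 2 * m - x by ring,
      show m - r = q' by linarith, show m + r = p' by linarith] at this
    linarith
  rcases le_total q' p with hqp | hqp
  · have hx : |p - m| ≤ r := abs_le.2 ⟨by linarith, by linarith⟩
    have : exp q ≤ exp (2 * m - p) := exp_le_exp.2 (by linarith)
    linarith [hspread hx]
  · linarith [exp_le_exp.2 hqp, exp_le_exp.2 hq]

theorem convexOn_cosh_sqrt : ConvexOn ℝ (Set.Ici 0) fun x => cosh √x := by
  have hsum {x : ℝ} (hx : x ∈ Set.Ici 0) :
      HasSum (fun k : ℕ => x ^ k / ((2 * k).factorial : ℝ)) (cosh √x) := by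
    simpa only [pow_mul, sq_sqrt hx] using hasSum_cosh √x
  refine ⟨convex_Ici 0, fun x hx y hy a b ha hb hab => ?_⟩
  refine hasSum_le (fun k => ?_) (hsum (convex_Ici 0 hx hy ha hb hab))
    (((hsum hx).mul_left a).add ((hsum hy).mul_left b))
  have hpow := (convexOn_pow (𝕜 := ℝ) k).2 hx hy ha hb hab
  calc (a • x + b • y) ^ k / ((2 * k).factorial : ℝ)
      ≤ (a • x ^ k + b • y ^ k) / ((2 * k).factorial : ℝ) := by gcongr
    _ = a * (x ^ k / (2 * k).factorial) + b * (y ^ k / (2 * k).factorial) := by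
        simp only [smul_eq_mul]; ring

theorem cosh_norm_add_add_cosh_norm_sub_le {E : Type*} [NormedAddCommGroup E]
    [InnerProductSpace ℝ E] (t : ℝ) (v x : E) :
    cosh (t * ‖v + x‖) + cosh (t * ‖v - x‖) ≤ 2 * (cosh (t * ‖v‖) * cosh (t * ‖x‖)) := by
  set a := t * ‖v‖
  set b := t * ‖x‖
  have hadd : a ^ 2 + b ^ 2 + 2 * t ^ 2 * inner ℝ v x = (t * ‖v + x‖) ^ 2 := by
    rw [mul_pow t ‖v + x‖, norm_add_sq_real]; ring
  have hsub : a ^ 2 + b ^ 2 - 2 * t ^ 2 * inner ℝ v x = (t * ‖v - x‖) ^ 2 := by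
    rw [mul_pow t ‖v - x‖, norm_sub_sq_real]; ring
  have hinner : |2 * t ^ 2 * inner ℝ v x| ≤ 2 * a * b := by
    rw [abs_mul, abs_of_nonneg (by positivity : 0 ≤ 2 * t ^ 2)]
    calc 2 * t ^ 2 * |inner ℝ v x| ≤ 2 * t ^ 2 * (‖v‖ * ‖x‖) := by
          gcongr; exact abs_real_inner_le_norm v x
      _ = 2 * a * b := by ring
  have hsub_sq : a ^ 2 + b ^ 2 - 2 * a * b = (a - b) ^ 2 := by ring
  have hadd_sq : a ^ 2 + b ^ 2 + 2 * a * b = (a + b) ^ 2 := by ring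
  have h := add_sub_le_add_sub_of_convexOn convexOn_cosh_sqrt hinner
    (hsub_sq ▸ Set.mem_Ici.2 (sq_nonneg _)) (hadd_sq ▸ Set.mem_Ici.2 (sq_nonneg _))
  simp only [hadd, hsub, hsub_sq, hadd_sq, sqrt_sq_eq_abs, cosh_abs, cosh_add, cosh_sub] at h
  linarith

end Convexity

section Signs

theorem sum_signs_smul_apply {ι κ : Type*} [Fintype ι] (s : ι → ℤˣ) (b : ι → κ → ℝ) (k : κ) :
    (∑ i, s i • b i) k = ∑ i, ((s i : ℤ) : ℝ) * b i k := by
  simp [Finset.sum_apply, Units.smul_def]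

variable {n : ℕ}

theorem expect_signs_succ (F : (Fin (n + 1) → ℤˣ) → ℝ) :
    𝔼 s, F s = (𝔼 s, F (Fin.cons 1 s) + 𝔼 s, F (Fin.cons (-1) s)) / 2 := by
  rw [← Fintype.expect_equiv (Fin.consEquiv fun _ => ℤˣ) (fun p => F (Fin.cons p.1 p.2)) F
    fun _ => rfl, ← Finset.univ_product_univ, Finset.expect_product, UnitsInt.univ,
    Finset.expect_eq_sum_div_card, Finset.sum_pair (by decide), Finset.card_pair (by decide)]
  norm_cast

theorem expect_signs_le_of_add_sub_le {V : Type*} [AddCommGroup V] {Φ : V → ℝ} {b c : Fin n → V}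
    (h : ∀ i a, Φ (a + c i) + Φ (a - c i) ≤ Φ (a + b i) + Φ (a - b i)) (a : V) :
    𝔼 s : Fin n → ℤˣ, Φ (a + ∑ i, s i • c i) ≤ 𝔼 s : Fin n → ℤˣ, Φ (a + ∑ i, s i • b i) := by
  induction n generalizing a with
  | zero => simp
  | succ n ih =>
    simp only [expect_signs_succ, Fin.sum_univ_succ, Fin.cons_zero, Fin.cons_succ, ← add_assoc,
      one_smul, Units.neg_smul, ← sub_eq_add_neg]
    gcongr ?_ / 2
    refine (add_le_add (ih (fun i => h i.succ) (a + c 0)) (ih (fun i => h i.succ) (a - c 0))).trans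
      ?_
    rw [← Finset.expect_add_distrib, ← Finset.expect_add_distrib]
    refine Finset.expect_le_expect fun s _ => ?_
    simpa only [add_right_comm, sub_add_eq_add_sub] using h 0 (a + ∑ i : Fin n, s i • b i.succ)

theorem expect_signs_le_mul_of_add_sub_le {V : Type*} [AddCommGroup V] {Φ : V → ℝ} {K : ℝ}
    (hK : 0 ≤ K) {x : Fin n → V} (h : ∀ i a, Φ (a + x i) + Φ (a - x i) ≤ 2 * (K * Φ a)) (a : V) :
    𝔼 s : Fin n → ℤˣ, Φ (a + ∑ i, s i • x i) ≤ K ^ n * Φ a := by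
  induction n generalizing a with
  | zero => simp
  | succ n ih =>
    simp only [expect_signs_succ, Fin.sum_univ_succ, Fin.cons_zero, Fin.cons_succ, ← add_assoc,
      one_smul, Units.neg_smul, ← sub_eq_add_neg]
    calc _ ≤ (K ^ n * Φ (a + x 0) + K ^ n * Φ (a - x 0)) / 2 := by
          gcongr <;> exact ih (fun i => h i.succ) _
      _ = K ^ n * (Φ (a + x 0) + Φ (a - x 0)) / 2 := by ring
      _ ≤ K ^ n * (2 * (K * Φ a)) / 2 := by gcongr; exact h 0 a
      _ = K ^ (n + 1) * Φ a := by ring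

theorem expect_exp_norm_sum_signs_le {E : Type*} [NormedAddCommGroup E] [InnerProductSpace ℝ E]
    {t : ℝ} (ht : 0 ≤ t) {x : Fin n → E} (hx : ∀ i, ‖x i‖ ≤ 1) :
    𝔼 s : Fin n → ℤˣ, exp (t * ‖∑ i, s i • x i‖) ≤ 2 * exp (n * (t ^ 2 / 2)) := by
  have hcosh (i : Fin n) : cosh (t * ‖x i‖) ≤ exp (t ^ 2 / 2) := by
    refine (cosh_le_exp_half_sq _).trans (exp_le_exp.2 ?_)
    gcongr
    exact mul_le_of_le_one_right ht (hx i)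
  have hstep (i : Fin n) (v : E) : cosh (t * ‖v + x i‖) + cosh (t * ‖v - x i‖) ≤
      2 * (exp (t ^ 2 / 2) * cosh (t * ‖v‖)) := by
    refine (cosh_norm_add_add_cosh_norm_sub_le t v (x i)).trans ?_
    rw [mul_comm (exp _)]
    gcongr
    exact hcosh i
  calc 𝔼 s : Fin n → ℤˣ, exp (t * ‖∑ i, s i • x i‖)
      ≤ 𝔼 s : Fin n → ℤˣ, 2 * cosh (t * ‖0 + ∑ i, s i • x i‖) := by
        refine Finset.expect_le_expect fun s _ => ?_
        rw [zero_add, cosh_eq]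
        linarith [exp_pos (-(t * ‖∑ i, s i • x i‖))]
    _ ≤ 2 * (exp (t ^ 2 / 2) ^ n * cosh (t * ‖(0 : E)‖)) := by
        rw [← Finset.mul_expect]
        gcongr
        exact expect_signs_le_mul_of_add_sub_le (Φ := fun v => cosh (t * ‖v‖)) (exp_pos _).le
          hstep 0
    _ = 2 * exp (n * (t ^ 2 / 2)) := by simp [exp_nat_mul]

theorem exp_expect_le_expect_exp {ι : Type*} [Fintype ι] [Nonempty ι] (F : ι → ℝ) :
    exp (𝔼 i, F i) ≤ 𝔼 i, exp (F i) := by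
  have hcard : (∑ _i : ι, (Fintype.card ι : ℝ)⁻¹) = 1 := by simp
  have := convexOn_exp.map_sum_le (t := Finset.univ) (w := fun _ => (Fintype.card ι : ℝ)⁻¹)
    (p := F) (fun _ _ => by positivity) hcard fun _ _ => Set.mem_univ _
  simpa only [smul_eq_mul, ← Finset.mul_sum, Fintype.expect_eq_sum_div_card, div_eq_inv_mul]
    using this

variable {ι κ : Type*} [Fintype ι] [DecidableEq ι]

/-- The empirical Rademacher complexity, without the usual factor `1 / |ι|`, of a family of
functions indexed by `κ`; `b i k` is the value of the `k`-th function at the `i`-th sample point. -/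
@[irreducible] def rademacherSum (b : ι → κ → ℝ) : ℝ :=
  𝔼 s : ι → ℤˣ, ⨆ k, (∑ i, s i • b i) k

theorem rademacherSum_const_mul {c : ℝ} (hc : 0 ≤ c)
    (b : ι → κ → ℝ) : rademacherSum (fun i k => c * b i k) = c * rademacherSum b := by
  have hsum (s : ι → ℤˣ) (k : κ) :
      (∑ i, s i • fun k => c * b i k) k = c * (∑ i, s i • b i) k := by
    rw [sum_signs_smul_apply, sum_signs_smul_apply, Finset.mul_sum]
    exact Finset.sum_congr rfl fun i _ => mul_left_comm _ _ _
  simp only [rademacherSum, hsum, Finset.mul_expect, Real.mul_iSup_of_nonneg hc]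

end Signs

section Contraction

variable {κ : Type*} [Finite κ]

theorem iSup_add_add_iSup_sub_le [Nonempty κ] {b c : κ → ℝ}
    (hc : ∀ k k', |c k - c k'| ≤ |b k - b k'|) (a : κ → ℝ) :
    (⨆ k, (a + c) k) + (⨆ k, (a - c) k) ≤ (⨆ k, (a + b) k) + (⨆ k, (a - b) k) := by
  obtain ⟨k, hk⟩ := exists_eq_ciSup_of_finite (f := a + c)
  obtain ⟨k', hk'⟩ := exists_eq_ciSup_of_finite (f := a - c)
  have hadd (j : κ) : a j + b j ≤ ⨆ k, (a + b) k :=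
    le_ciSup (Set.finite_range (a + b)).bddAbove j
  have hsub (j : κ) : a j - b j ≤ ⨆ k, (a - b) k :=
    le_ciSup (Set.finite_range (a - b)).bddAbove j
  have hcb := (le_abs_self _).trans (hc k k')
  rw [← hk, ← hk']
  change a k + c k + (a k' - c k') ≤ _
  rcases abs_cases (b k - b k') with ⟨h, -⟩ | ⟨h, -⟩
  · linarith [hadd k, hsub k']
  · linarith [hadd k', hsub k]

theorem exp_iSup_add_abs_add_exp_iSup_sub_abs_le {t : ℝ} (ht : 0 ≤ t) (a b : κ → ℝ) :
    exp (t * ⨆ k, (a + |b|) k) + exp (t * ⨆ k, (a - |b|) k) ≤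
      exp (t * ⨆ k, (a + b) k) + exp (t * ⨆ k, (a - b) k) := by
  rcases isEmpty_or_nonempty κ with hκ | hκ
  · simp [Real.iSup_of_isEmpty]
  have hmax (k : κ) : (a + |b|) k ≤ max (⨆ k, (a + b) k) (⨆ k, (a - b) k) := by
    rcases abs_choice (b k) with h | h
    · refine le_max_of_le_left (le_trans (le_of_eq ?_) (le_ciSup (Set.finite_range _).bddAbove k))
      simp [h]
    · refine le_max_of_le_right (le_trans (le_of_eq ?_) (le_ciSup (Set.finite_range _).bddAbove k))
      simp [h, sub_eq_add_neg]
  have hmax' (k : κ) : (a - |b|) k ≤ max (⨆ k, (a + b) k) (⨆ k, (a - b) k) :=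
    le_trans (by simp only [Pi.add_apply, Pi.sub_apply, Pi.abs_apply]; linarith [abs_nonneg (b k)])
      (hmax k)
  apply exp_add_exp_le_exp_add_exp
  · rw [← mul_add, ← mul_add]
    exact mul_le_mul_of_nonneg_left
      (iSup_add_add_iSup_sub_le (fun k k' => abs_abs_sub_abs_le (b k) (b k')) a) ht
  all_goals
    rw [← mul_max_of_nonneg _ _ ht]
    exact mul_le_mul_of_nonneg_left (ciSup_le ‹_›) ht

variable {n : ℕ}

theorem expect_exp_iSup_sum_signs_abs_le {t : ℝ} (ht : 0 ≤ t) (b : Fin n → κ → ℝ) :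
    𝔼 s : Fin n → ℤˣ, exp (t * ⨆ k, (∑ i, s i • |b i|) k) ≤
      𝔼 s : Fin n → ℤˣ, exp (t * ⨆ k, (∑ i, s i • b i) k) := by
  simpa only [zero_add] using
    expect_signs_le_of_add_sub_le (Φ := fun v : κ → ℝ => exp (t * ⨆ k, v k))
      (fun i a => exp_iSup_add_abs_add_exp_iSup_sub_abs_le ht a (b i)) 0

theorem rademacherSum_le_of_abs_sub_le {b c : Fin n → κ → ℝ}
    (hc : ∀ i k k', |c i k - c i k'| ≤ |b i k - b i k'|) : rademacherSum c ≤ rademacherSum b := by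
  rcases isEmpty_or_nonempty κ with hκ | hκ
  · simp [rademacherSum]
  simpa only [zero_add, rademacherSum] using
    expect_signs_le_of_add_sub_le (Φ := fun v : κ → ℝ => ⨆ k, v k)
      (fun i a => iSup_add_add_iSup_sub_le (hc i) a) 0

theorem expect_exp_iSup_abs_sum_signs_abs_le {t : ℝ} (ht : 0 ≤ t) (b : Fin n → κ → ℝ) :
    𝔼 s : Fin n → ℤˣ, exp (t * ⨆ k, |(∑ i, s i • |b i|) k|) ≤
      2 * 𝔼 s : Fin n → ℤˣ, exp (t * ⨆ k, |(∑ i, s i • b i) k|) := by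
  rcases isEmpty_or_nonempty κ with hκ | hκ
  · simp [Real.iSup_of_isEmpty]
  set V : (Fin n → ℤˣ) → ℝ := fun s => ⨆ k, (∑ i, s i • |b i|) k
  have hpoint (s : Fin n → ℤˣ) :
      exp (t * ⨆ k, |(∑ i, s i • |b i|) k|) ≤ exp (t * V s) + exp (t * V (-s)) := by
    obtain ⟨k, hk⟩ := exists_eq_ciSup_of_finite (f := fun k => |(∑ i, s i • |b i|) k|)
    have hle (u : Fin n → ℤˣ) : (∑ i, u i • |b i|) k ≤ V u :=
      le_ciSup (Set.finite_range fun k => (∑ i, u i • |b i|) k).bddAbove k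
    rw [← hk]
    rcases abs_choice ((∑ i, s i • |b i|) k) with h | h <;> rw [h]
    · exact (exp_le_exp.2 (by gcongr; exact hle s)).trans (le_add_of_nonneg_right (exp_pos _).le)
    · refine (exp_le_exp.2 (mul_le_mul_of_nonneg_left ?_ ht)).trans
        (le_add_of_nonneg_left (exp_pos _).le)
      simpa [Units.neg_smul] using hle (-s)
  have hneg : 𝔼 s, exp (t * V (-s)) = 𝔼 s, exp (t * V s) :=
    Fintype.expect_equiv (Equiv.neg _) _ _ fun _ => rfl
  have hV_le : 𝔼 s, exp (t * V s) ≤ 𝔼 s : Fin n → ℤˣ, exp (t * ⨆ k, |(∑ i, s i • b i) k|) := by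
    refine (expect_exp_iSup_sum_signs_abs_le ht b).trans (Finset.expect_le_expect fun s _ => ?_)
    gcongr
    exacts [(Set.finite_range _).bddAbove, le_abs_self _]
  calc _ ≤ 𝔼 s, (exp (t * V s) + exp (t * V (-s))) :=
        Finset.expect_le_expect fun s _ => hpoint s
    _ = 2 * 𝔼 s, exp (t * V s) := by rw [Finset.expect_add_distrib, hneg, two_mul]
    _ ≤ _ := by gcongr

theorem expect_exp_iSup_abs_le_three_mul {κ' : Type*} {t r : ℝ} (ht : 0 ≤ t) (hr : 0 ≤ r)
    {a : Fin n → κ' → ℝ} {b : Fin n → κ → ℝ}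
    (h : ∀ (s : Fin n → ℤˣ) k', |(∑ i, s i • a i) k'| ≤
      r * max (⨆ k, |(∑ i, s i • b i) k|) (⨆ k, |(∑ i, s i • |b i|) k|)) :
    𝔼 s : Fin n → ℤˣ, exp (t * ⨆ k', |(∑ i, s i • a i) k'|) ≤
      3 * 𝔼 s : Fin n → ℤˣ, exp (t * r * ⨆ k, |(∑ i, s i • b i) k|) := by
  have htr : 0 ≤ t * r := mul_nonneg ht hr
  have hpoint (s : Fin n → ℤˣ) : exp (t * ⨆ k', |(∑ i, s i • a i) k'|) ≤
      exp (t * r * ⨆ k, |(∑ i, s i • b i) k|) + exp (t * r * ⨆ k, |(∑ i, s i • |b i|) k|) := by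
    have hsup := Real.iSup_le (h s) <| mul_nonneg hr <|
      le_max_of_le_left (Real.iSup_nonneg fun k => abs_nonneg _)
    refine (exp_le_exp.2 (mul_le_mul_of_nonneg_left hsup ht)).trans ?_
    rw [← mul_assoc, mul_max_of_nonneg _ _ htr, exp_monotone.map_max]
    exact max_le_add_of_nonneg (exp_pos _).le (exp_pos _).le
  have h_abs := expect_exp_iSup_abs_sum_signs_abs_le htr b
  have := Finset.expect_le_expect fun s (_ : s ∈ Finset.univ) => hpoint s
  rw [Finset.expect_add_distrib] at this
  linarith

end Contraction

section Networks

theorem IsActivation.map_zero {φ : ℝ → ℝ} (hφ : IsActivation φ) : φ 0 = 0 := by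
  simpa using hφ.posHomogeneous 0 0 le_rfl

theorem IsActivation.abs_le_abs {φ : ℝ → ℝ} (hφ : IsActivation φ) (t : ℝ) : |φ t| ≤ |t| := by
  simpa [hφ.map_zero, Real.dist_eq] using hφ.lipschitz.dist_le_mul t 0

theorem IsActivation.exists_eq_mul_add_mul_abs {φ : ℝ → ℝ} (hφ : IsActivation φ) :
    ∃ α β : ℝ, |α| + |β| ≤ 1 ∧ ∀ t, φ t = α * t + β * |t| := by
  refine ⟨(φ 1 - φ (-1)) / 2, (φ 1 + φ (-1)) / 2, ?_, fun t => ?_⟩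
  · obtain ⟨h₁, h₁'⟩ := abs_le.1 (hφ.abs_le_abs 1)
    obtain ⟨h₂, h₂'⟩ := abs_le.1 (hφ.abs_le_abs (-1))
    simp only [abs_neg, abs_one] at h₁ h₁' h₂ h₂'
    rcases abs_choice ((φ 1 - φ (-1)) / 2) with h | h <;>
    rcases abs_choice ((φ 1 + φ (-1)) / 2) with h' | h' <;> rw [h, h'] <;> linarith
  · rcases le_total 0 t with ht | ht
    · have := hφ.posHomogeneous t 1 ht
      rw [mul_one] at this
      rw [this, abs_of_nonneg ht]
      ring
    · have := hφ.posHomogeneous (-t) (-1) (by linarith)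
      rw [neg_mul_neg, mul_one] at this
      rw [this, abs_of_nonpos ht]
      ring

theorem abs_sum_mul_le {m : Type*} [Fintype m] {d u : m → ℝ} {r q : ℝ} (hq : 0 ≤ q)
    (hd : ∑ j, |d j| ≤ r) (hu : ∀ j, |u j| ≤ q) : |∑ j, d j * u j| ≤ r * q :=
  calc |∑ j, d j * u j| ≤ ∑ j, |d j| * |u j| := by
        simpa only [abs_mul] using Finset.abs_sum_le_sum_abs (fun j => d j * u j) Finset.univ
    _ ≤ ∑ j, |d j| * q := by gcongr with j; exact hu j
    _ ≤ r * q := by rw [← Finset.sum_mul]; gcongr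

theorem abs_mul_add_mul_le_max {α β u v U V : ℝ} (hαβ : |α| + |β| ≤ 1) (hu : |u| ≤ U)
    (hv : |v| ≤ V) : |α * u + β * v| ≤ max U V := by
  have hmax : 0 ≤ max U V := le_max_of_le_left ((abs_nonneg u).trans hu)
  calc |α * u + β * v| ≤ |α| * |u| + |β| * |v| := by
        simpa only [abs_mul] using abs_add_le (α * u) (β * v)
    _ ≤ |α| * max U V + |β| * max U V := by
        gcongr
        exacts [hu.trans (le_max_left _ _), hv.trans (le_max_right _ _)]
    _ ≤ max U V := by
        rw [← add_mul]
        exact mul_le_of_le_one_left hmax hαβ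

section FrobNorm

variable {m k : Type} [Fintype m] [Fintype k]

theorem frobNorm_sq (W : Matrix m k ℝ) : frobNorm W ^ 2 = ∑ i, ∑ j, W i j ^ 2 := by
  rw [frobNorm, Matrix.frobenius_norm_def, ← sqrt_eq_rpow, sq_sqrt (by positivity)]
  simp

theorem frobNorm_nonneg (W : Matrix m k ℝ) : 0 ≤ frobNorm W := by
  rw [frobNorm, Matrix.frobenius_norm_def]
  positivity

open scoped Matrix.Norms.Frobenius in
theorem frobNorm_smul (c : ℝ) (W : Matrix m k ℝ) : frobNorm (c • W) = |c| * frobNorm W :=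
  norm_smul c W

theorem exists_mulVec_eq_mul_of_frobNorm_le {W : Matrix m k ℝ} {r : ℝ} (hW : frobNorm W ≤ r) :
    ∃ (c : m → ℝ) (V : m → Matrix (Fin 1) k ℝ), (∀ j, 0 ≤ c j) ∧ ∑ j, c j ^ 2 ≤ 1 ∧
      (∀ j, frobNorm (V j) ≤ r) ∧ ∀ j v, W.mulVec v j = c j * (V j).mulVec v 0 := by
  have hr : 0 ≤ r := (frobNorm_nonneg W).trans hW
  set row : m → Matrix (Fin 1) k ℝ := fun j => Matrix.replicateRow (Fin 1) (W j)
  set ρ : m → ℝ := fun j => frobNorm (row j) with hρ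
  have hρ_nonneg (j : m) : 0 ≤ ρ j := frobNorm_nonneg _
  have hρ_sq (j : m) : ρ j ^ 2 = ∑ i, W j i ^ 2 := by simp [hρ, row, frobNorm_sq]
  have hρ_sum : ∑ j, ρ j ^ 2 = frobNorm W ^ 2 := by simp only [hρ_sq, frobNorm_sq]
  have hρ_le (j : m) : ρ j ≤ r := by
    refine (pow_le_pow_iff_left₀ (hρ_nonneg j) hr two_ne_zero).1 ?_
    calc ρ j ^ 2 ≤ ∑ j, ρ j ^ 2 :=
          Finset.single_le_sum (fun j _ => sq_nonneg (ρ j)) (Finset.mem_univ j)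
      _ ≤ r ^ 2 := by rw [hρ_sum]; exact pow_le_pow_left₀ (frobNorm_nonneg W) hW 2
  refine ⟨fun j => ρ j / r, fun j => (r / ρ j) • row j, fun j => div_nonneg (hρ_nonneg j) hr,
    ?_, fun j => ?_, fun j v => ?_⟩
  · simp only [div_pow, ← Finset.sum_div, hρ_sum]
    exact div_le_one_of_le₀ (pow_le_pow_left₀ (frobNorm_nonneg W) hW 2) (by positivity)
  · rw [frobNorm_smul, abs_of_nonneg (div_nonneg hr (hρ_nonneg j)), div_mul_eq_mul_div,
      mul_div_assoc]
    exact mul_le_of_le_one_right hr (div_self_le_one _)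
  · have hrow : (row j).mulVec v 0 = W.mulVec v j := rfl
    rw [Matrix.smul_mulVec, Pi.smul_apply, smul_eq_mul, hrow]
    rcases (hρ_nonneg j).eq_or_lt with h₀ | h₀
    · have hWj (i : k) : W j i = 0 := by
        have := hρ_sq j
        rw [← h₀, zero_pow two_ne_zero, eq_comm,
          Finset.sum_eq_zero_iff_of_nonneg fun i _ => sq_nonneg _] at this
        exact pow_eq_zero_iff two_ne_zero |>.1 (this i (Finset.mem_univ i))
      simp [Matrix.mulVec, dotProduct, hWj]
    · have : 0 < r := h₀.trans_le (hρ_le j)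
      field_simp

end FrobNorm

theorem gammaF_one (R : ℕ → ℝ) : gammaF 1 R = R 1 := by simp [gammaF]

theorem gammaF_succ (l : ℕ) (R : ℕ → ℝ) : gammaF (l + 1) R = gammaF l R * R (l + 1) :=
  Finset.prod_Icc_succ_top (by omega) R

variable {ι : Type} [Fintype ι] {R : ℕ → ℝ} {l : ℕ}

theorem Network.Admissible.exists_eval_eq_mul {m : ℕ} {N : Network ι l m} (hN : N.Admissible R) :
    ∃ (c : Fin m → ℝ) (g : Fin m → EuclideanSpace ℝ ι → ℝ), (∀ j, 0 ≤ c j) ∧ ∑ j, c j ^ 2 ≤ 1 ∧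
      (∀ j, g j ∈ networkClass ι l R) ∧ ∀ j x, N.eval x j = c j * g j x := by
  cases N with
  | first W =>
    obtain ⟨c, V, hc₀, hc, hV, h⟩ := exists_mulVec_eq_mul_of_frobNorm_le (W := W) hN
    exact ⟨c, fun j x => (V j).mulVec x.ofLp 0, hc₀, hc,
      fun j => ⟨.first (V j), hV j, fun _ => rfl⟩, fun j x => h j _⟩
  | layer N φ W =>
    obtain ⟨c, V, hc₀, hc, hV, h⟩ := exists_mulVec_eq_mul_of_frobNorm_le hN.2.2
    exact ⟨c, fun j x => (V j).mulVec (fun i => φ (N.eval x i)) 0, hc₀, hc,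
      fun j => ⟨.layer N φ (V j), ⟨hN.1, hN.2.1, hV j⟩, fun _ => rfl⟩, fun j x => h j _⟩

theorem exists_inner_of_mem_networkClass_one {f : EuclideanSpace ℝ ι → ℝ}
    (hf : f ∈ networkClass ι 1 R) :
    ∃ w : EuclideanSpace ℝ ι, ‖w‖ ≤ R 1 ∧ ∀ x, f x = inner ℝ w x := by
  obtain ⟨N, hN, h⟩ := hf
  cases N with
  | first W =>
    refine ⟨WithLp.toLp 2 (W 0), le_trans (le_of_eq ?_) hN, fun x => ?_⟩
    · rw [EuclideanSpace.norm_eq, ← sqrt_sq (frobNorm_nonneg W), frobNorm_sq]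
      simp
    · simp [h, Network.eval, Matrix.mulVec, dotProduct, PiLp.inner_apply, mul_comm]
  | layer N φ W => cases N

theorem exists_sum_of_mem_networkClass_succ (hl : 1 ≤ l) {f : EuclideanSpace ℝ ι → ℝ}
    (hf : f ∈ networkClass ι (l + 1) R) :
    ∃ (m : ℕ) (d : Fin m → ℝ) (g : Fin m → EuclideanSpace ℝ ι → ℝ) (φ : ℝ → ℝ),
      ∑ j, |d j| ≤ R (l + 1) ∧ (∀ j, g j ∈ networkClass ι l R) ∧ IsActivation φ ∧
      ∀ x, f x = ∑ j, d j * φ (g j x) := by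
  obtain ⟨N, hN, h⟩ := hf
  cases N with
  | first W => omega
  | @layer _ k _ N φ W =>
    obtain ⟨hN, hφ, hW⟩ := hN
    obtain ⟨c, g, hc₀, hc, hg, hN⟩ := hN.exists_eval_eq_mul
    refine ⟨k, fun j => W 0 j * c j, g, φ, ?_, hg, hφ, fun x => ?_⟩
    · have hW_sq : ∑ j, |W 0 j| ^ 2 = frobNorm W ^ 2 := by simp [frobNorm_sq]
      refine abs_le_of_sq_le_sq' ?_ ((frobNorm_nonneg W).trans hW) |>.2
      calc (∑ j, |W 0 j * c j|) ^ 2 = (∑ j, |W 0 j| * c j) ^ 2 := by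
            simp only [abs_mul, abs_of_nonneg (hc₀ _)]
        _ ≤ (∑ j, |W 0 j| ^ 2) * ∑ j, c j ^ 2 := Finset.sum_mul_sq_le_sq_mul_sq _ _ _
        _ ≤ frobNorm W ^ 2 * 1 := by rw [hW_sq]; gcongr
        _ ≤ R (l + 1) ^ 2 := by rw [mul_one]; gcongr; exact frobNorm_nonneg W
    · simp only [h, Network.eval, Matrix.mulVec, dotProduct, hN, hφ.posHomogeneous _ _ (hc₀ _),
        mul_assoc]

variable {f : EuclideanSpace ℝ ι → ℝ}

theorem Network.Admissible.nonneg {m : ℕ} {N : Network ι l m} (hN : N.Admissible R) :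
    ∀ i ∈ Finset.Icc 1 l, 0 ≤ R i := by
  induction N with
  | first W =>
    rw [Finset.Icc_self]
    exact fun i hi => (Finset.mem_singleton.1 hi) ▸ (frobNorm_nonneg W).trans hN
  | @layer l _ _ N φ W ih =>
    rw [← Finset.insert_Icc_right_eq_Icc_add_one (by omega)]
    exact Finset.forall_mem_insert _ _ _ |>.2 ⟨(frobNorm_nonneg W).trans hN.2.2, ih hN.1⟩

theorem nonneg_of_mem_networkClass (hf : f ∈ networkClass ι l R) :
    ∀ i ∈ Finset.Icc 1 l, 0 ≤ R i :=
  let ⟨_, hN, _⟩ := hf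
  hN.nonneg

theorem continuous_of_mem_networkClass (hl : 1 ≤ l) (hf : f ∈ networkClass ι l R) :
    Continuous f := by
  induction l, hl using Nat.le_induction generalizing f with
  | base =>
    obtain ⟨w, -, h⟩ := exists_inner_of_mem_networkClass_one hf
    rw [funext h]
    fun_prop
  | succ l hl ih =>
    obtain ⟨m, d, g, φ, -, hg, hφ, h⟩ := exists_sum_of_mem_networkClass_succ hl hf
    rw [funext h]
    exact continuous_finsetSum _ fun j _ =>
      continuous_const.mul (hφ.lipschitz.continuous.comp (ih (hg j)))

theorem map_smul_of_mem_networkClass (hl : 1 ≤ l) (hf : f ∈ networkClass ι l R) {c : ℝ}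
    (hc : 0 ≤ c) (x : EuclideanSpace ℝ ι) : f (c • x) = c * f x := by
  induction l, hl using Nat.le_induction generalizing f with
  | base =>
    obtain ⟨w, -, h⟩ := exists_inner_of_mem_networkClass_one hf
    rw [h, h, inner_smul_right]
  | succ l hl ih =>
    obtain ⟨m, d, g, φ, -, hg, hφ, h⟩ := exists_sum_of_mem_networkClass_succ hl hf
    simp only [h, ih (hg _), hφ.posHomogeneous _ _ hc, Finset.mul_sum, mul_left_comm]

theorem abs_le_of_mem_networkClass (hl : 1 ≤ l) (hf : f ∈ networkClass ι l R)
    (x : EuclideanSpace ℝ ι) : |f x| ≤ gammaF l R * ‖x‖ := by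
  induction l, hl using Nat.le_induction generalizing f with
  | base =>
    obtain ⟨w, hw, h⟩ := exists_inner_of_mem_networkClass_one hf
    rw [h, gammaF_one]
    exact (abs_real_inner_le_norm _ _).trans (by gcongr)
  | succ l hl ih =>
    have hΓ : 0 ≤ gammaF l R := Finset.prod_nonneg fun i hi =>
      nonneg_of_mem_networkClass hf i (Finset.Icc_subset_Icc_right l.le_succ hi)
    obtain ⟨m, d, g, φ, hd, hg, hφ, h⟩ := exists_sum_of_mem_networkClass_succ hl hf
    rw [h, gammaF_succ, mul_right_comm, mul_comm]
    exact abs_sum_mul_le (by positivity) hd fun j => (hφ.abs_le_abs _).trans (ih (hg j))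

end Networks

section Peeling

variable {ι : Type} [Fintype ι] {R : ℕ → ℝ} {l n : ℕ} {κ : Type*}
  {f : κ → EuclideanSpace ℝ ι → ℝ}

theorem expect_exp_iSup_abs_networkClass_one_le {t : ℝ} (ht : 0 ≤ t) (hR : 0 ≤ R 1)
    (hf : ∀ k, f k ∈ networkClass ι 1 R) (x : Fin n → EuclideanSpace ℝ ι) :
    𝔼 s : Fin n → ℤˣ, exp (t * ⨆ k, |(∑ i, s i • fun k => f k (x i)) k|) ≤
      𝔼 s : Fin n → ℤˣ, exp (t * R 1 * ‖∑ i, s i • x i‖) := by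
  refine Finset.expect_le_expect fun s _ => exp_le_exp.2 ?_
  rw [mul_assoc]
  refine mul_le_mul_of_nonneg_left (Real.iSup_le (fun k => ?_) (by positivity)) ht
  obtain ⟨w, hw, h⟩ := exists_inner_of_mem_networkClass_one (hf k)
  have hsum : (∑ i, s i • fun k => f k (x i)) k = inner ℝ w (∑ i, s i • x i) := by
    simp [inner_sum, h, Units.smul_def, ← Int.cast_smul_eq_zsmul ℝ,
      inner_smul_right]
  rw [hsum]
  exact (abs_real_inner_le_norm _ _).trans (by gcongr)

theorem expect_exp_iSup_abs_networkClass_le [Finite κ] (hl : 1 ≤ l) {t : ℝ} (ht : 0 ≤ t)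
    (hR : ∀ i ∈ Finset.Icc 1 l, 0 ≤ R i) (hf : ∀ k, f k ∈ networkClass ι l R)
    (x : Fin n → EuclideanSpace ℝ ι) :
    𝔼 s : Fin n → ℤˣ, exp (t * ⨆ k, |(∑ i, s i • fun k => f k (x i)) k|) ≤
      3 ^ l * 𝔼 s : Fin n → ℤˣ, exp (t * gammaF l R * ‖∑ i, s i • x i‖) := by
  induction l, hl using Nat.le_induction generalizing κ t with
  | base =>
    rw [gammaF_one]
    refine (expect_exp_iSup_abs_networkClass_one_le ht (hR 1 (by simp)) hf x).trans ?_
    exact le_mul_of_one_le_left (Finset.expect_nonneg fun s _ => (exp_pos _).le) (by norm_num)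
  | succ l hl ih =>
    have hR_last : 0 ≤ R (l + 1) := hR (l + 1) (by simp)
    choose m d g φ hd hg hφ h using fun k => exists_sum_of_mem_networkClass_succ hl (hf k)
    choose α β hαβ hφ_eq using fun k => (hφ k).exists_eq_mul_add_mul_abs
    set b : Fin n → (Σ k, Fin (m k)) → ℝ := fun i p => g p.1 p.2 (x i) with hb
    have hpeel (s : Fin n → ℤˣ) (k : κ) : |(∑ i, s i • fun k => f k (x i)) k| ≤
        R (l + 1) * max (⨆ p, |(∑ i, s i • b i) p|) (⨆ p, |(∑ i, s i • |b i|) p|) := by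
      have hsum : (∑ i, s i • fun k => f k (x i)) k = ∑ j, d k j *
          (α k * (∑ i, s i • b i) ⟨k, j⟩ + β k * (∑ i, s i • |b i|) ⟨k, j⟩) := by
        simp only [sum_signs_smul_apply, h, hφ_eq, hb, Pi.abs_apply, Finset.mul_sum,
          ← Finset.sum_add_distrib]
        rw [Finset.sum_comm]
        exact Finset.sum_congr rfl fun j _ => Finset.sum_congr rfl fun i _ => by ring
      rw [hsum]
      refine abs_sum_mul_le (le_max_of_le_left (Real.iSup_nonneg fun p => abs_nonneg _)) (hd k)
        fun j => abs_mul_add_mul_le_max (hαβ k) ?_ ?_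
      · exact le_ciSup (Set.finite_range fun p => |(∑ i, s i • b i) p|).bddAbove ⟨k, j⟩
      · exact le_ciSup (Set.finite_range fun p => |(∑ i, s i • |b i|) p|).bddAbove ⟨k, j⟩
    have := expect_exp_iSup_abs_le_three_mul ht hR_last hpeel
    have hR' : ∀ i ∈ Finset.Icc 1 l, 0 ≤ R i := fun i hi =>
      hR i (Finset.Icc_subset_Icc_right l.le_succ hi)
    have hih := ih (mul_nonneg ht hR_last) hR' (f := fun p : Σ k, Fin (m k) => g p.1 p.2)
      fun p => hg p.1 p.2
    calc _ ≤ 3 * _ := this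
      _ ≤ 3 * (3 ^ l * _) := by gcongr
      _ = _ := by
        rw [← mul_assoc, ← pow_succ', gammaF_succ, mul_right_comm t, mul_assoc t]

theorem mul_rademacherSum_networkClass_le [Finite κ] (hl : 1 ≤ l) {t : ℝ} (ht : 0 ≤ t)
    (hR : ∀ i ∈ Finset.Icc 1 l, 0 ≤ R i) (hf : ∀ k, f k ∈ networkClass ι l R)
    {x : Fin n → EuclideanSpace ℝ ι} (hx : ∀ i, ‖x i‖ ≤ 1) :
    t * rademacherSum (fun i k => f k (x i)) ≤ 2 * l + n * ((t * gammaF l R) ^ 2 / 2) := by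
  have hΓ : 0 ≤ gammaF l R := Finset.prod_nonneg hR
  have hlog : (3 : ℝ) ^ l * 2 ≤ exp (2 * l) := by
    have h_exp : (7 : ℝ) ≤ exp 2 := by
      have := exp_one_gt_d9
      rw [show (2 : ℝ) = 1 + 1 by norm_num, exp_add]
      nlinarith
    calc (3 : ℝ) ^ l * 2 ≤ 3 ^ l * 2 ^ l := by gcongr; exact le_self_pow₀ one_le_two (by omega)
      _ = 6 ^ l := by rw [← mul_pow]; norm_num
      _ ≤ exp 2 ^ l := by gcongr; linarith
      _ = exp (2 * l) := by rw [← exp_nat_mul, mul_comm]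
  have hsup (s : Fin n → ℤˣ) : (⨆ k, (∑ i, s i • fun k => f k (x i)) k) ≤
      ⨆ k, |(∑ i, s i • fun k => f k (x i)) k| :=
    ciSup_mono (Set.finite_range _).bddAbove fun k => le_abs_self _
  rw [rademacherSum, Finset.mul_expect, ← exp_le_exp]
  calc exp (𝔼 s : Fin n → ℤˣ, t * ⨆ k, (∑ i, s i • fun k => f k (x i)) k)
      ≤ 𝔼 s : Fin n → ℤˣ, exp (t * ⨆ k, (∑ i, s i • fun k => f k (x i)) k) :=
        exp_expect_le_expect_exp _
    _ ≤ 𝔼 s : Fin n → ℤˣ, exp (t * ⨆ k, |(∑ i, s i • fun k => f k (x i)) k|) :=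
        Finset.expect_le_expect fun s _ => by
          exact exp_le_exp.2 (mul_le_mul_of_nonneg_left (hsup s) ht)
    _ ≤ 3 ^ l * 𝔼 s : Fin n → ℤˣ, exp (t * gammaF l R * ‖∑ i, s i • x i‖) :=
        expect_exp_iSup_abs_networkClass_le hl ht hR hf x
    _ ≤ 3 ^ l * (2 * exp (n * ((t * gammaF l R) ^ 2 / 2))) := by
        gcongr
        exact expect_exp_norm_sum_signs_le (by positivity) hx
    _ ≤ exp (2 * l + n * ((t * gammaF l R) ^ 2 / 2)) := by
        rw [← mul_assoc, exp_add]
        gcongr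

theorem rademacherSum_networkClass_le [Finite κ] (hl : 1 ≤ l) (hn : 0 < n)
    (hR : ∀ i ∈ Finset.Icc 1 l, 0 ≤ R i) (hΓ : 0 < gammaF l R)
    (hf : ∀ k, f k ∈ networkClass ι l R) {x : Fin n → EuclideanSpace ℝ ι} (hx : ∀ i, ‖x i‖ ≤ 1) :
    rademacherSum (fun i k => f k (x i)) ≤ 2 * gammaF l R * (n * √(l / n)) := by
  set q := √((l : ℝ) / n)
  have hq : 0 < q := by positivity
  have hq_sq : (l : ℝ) = n * q ^ 2 := by rw [sq_sqrt (by positivity)]; field_simp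
  have h := mul_rademacherSum_networkClass_le hl (t := 2 * q / gammaF l R) (by positivity) hR hf hx
  rw [div_mul_cancel₀ _ hΓ.ne', div_mul_eq_mul_div, div_le_iff₀ hΓ, hq_sq] at h
  refine le_of_mul_le_mul_left (h.trans_eq ?_) (mul_pos two_pos hq)
  ring

end Peeling

section Concentration

open ProbabilityTheory (HasSubgaussianMGF hasSubgaussianMGF_of_mem_Icc)

theorem hasSubgaussianMGF_sub_integral_of_forall_le_add {α : Type*} [MeasurableSpace α]
    {μ : Measure α} [IsProbabilityMeasure μ] {g : α → ℝ} (hg : Measurable g) {c : ℝ≥0}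
    (hc : ∀ x y, g x ≤ g y + c) :
    HasSubgaussianMGF (fun x => g x - ∫ y, g y ∂μ) ((c / 2) ^ 2) μ := by
  obtain ⟨x₀⟩ := nonempty_of_isProbabilityMeasure μ
  have : Nonempty α := ⟨x₀⟩
  have hbdd : BddBelow (Set.range g) := by
    refine ⟨g x₀ - c, ?_⟩
    rintro _ ⟨x, rfl⟩
    linarith [hc x₀ x]
  have hmem x : g x ∈ Set.Icc (⨅ y, g y) ((⨅ y, g y) + c) := by
    have : g x - c ≤ ⨅ y, g y := le_ciInf fun y => by linarith [hc x y]
    exact ⟨ciInf_le hbdd x, by linarith⟩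
  simpa using hasSubgaussianMGF_of_mem_Icc (μ := μ) hg.aemeasurable (.of_forall hmem)

theorem hasSubgaussianMGF_prod_add {α β : Type*} [MeasurableSpace α] [MeasurableSpace β]
    {μ : Measure α} {ν : Measure β} [SFinite μ] [SFinite ν] {X : α → ℝ} {Y : α × β → ℝ}
    {cX cY : ℝ≥0}
    (hX : HasSubgaussianMGF X cX μ) (hYm : Measurable Y)
    (hY : ∀ x, HasSubgaussianMGF (fun y => Y (x, y)) cY ν) :
    HasSubgaussianMGF (fun p => X p.1 + Y p) (cX + cY) (μ.prod ν) := by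
  have hsplit (t : ℝ) (p : α × β) :
      exp (t * (X p.1 + Y p)) = exp (t * X p.1) * exp (t * Y p) := by
    rw [mul_add, exp_add]
  have hinner (t : ℝ) (x : α) :
      ∫ y, exp (t * (X x + Y (x, y))) ∂ν ≤ exp (t * X x) * exp (cY * t ^ 2 / 2) := by
    simp only [fun y => hsplit t (x, y), integral_const_mul]
    exact mul_le_mul_of_nonneg_left ((hY x).mgf_le t) (exp_pos _).le
  have hint (t : ℝ) : Integrable (fun p : α × β => exp (t * (X p.1 + Y p))) (μ.prod ν) := by
    have hm : AEStronglyMeasurable (fun p : α × β => exp (t * (X p.1 + Y p))) (μ.prod ν) :=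
      continuous_exp.comp_aestronglyMeasurable
        ((hX.aestronglyMeasurable.comp_fst.add hYm.aestronglyMeasurable).const_mul t)
    refine (integrable_prod_iff hm).2 ⟨.of_forall fun x => ?_, ?_⟩
    · simp only [fun y => hsplit t (x, y)]
      exact ((hY x).integrable_exp_mul t).const_mul _
    · refine ((hX.integrable_exp_mul t).mul_const (exp (cY * t ^ 2 / 2))).mono'
        hm.norm.integral_prod_right' (.of_forall fun x => ?_)
      rw [norm_of_nonneg (integral_nonneg fun y => norm_nonneg _)]
      simpa only [norm_of_nonneg (exp_pos _).le] using hinner t x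
  refine ⟨hint, fun t => ?_⟩
  calc ∫ p, exp (t * (X p.1 + Y p)) ∂μ.prod ν
      = ∫ x, ∫ y, exp (t * (X x + Y (x, y))) ∂ν ∂μ := integral_prod _ (hint t)
    _ ≤ ∫ x, exp (t * X x) * exp (cY * t ^ 2 / 2) ∂μ :=
      integral_mono (hint t).integral_prod_left ((hX.integrable_exp_mul t).mul_const _) (hinner t)
    _ ≤ exp (cX * t ^ 2 / 2) * exp (cY * t ^ 2 / 2) := by
      rw [integral_mul_const]
      exact mul_le_mul_of_nonneg_right (hX.mgf_le t) (exp_pos _).le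
    _ = exp ((cX + cY : ℝ≥0) * t ^ 2 / 2) := by
      rw [← exp_add]
      push_cast
      ring_nf

theorem measurePreserving_head_tail {n : ℕ} {Z : Fin (n + 1) → Type*}
    [∀ i, MeasurableSpace (Z i)] (μ : ∀ i, Measure (Z i)) [∀ i, SigmaFinite (μ i)] :
    MeasurePreserving (fun S : ∀ i, Z i => (S 0, Fin.tail S)) (Measure.pi μ)
      ((μ 0).prod (Measure.pi fun i : Fin n => μ i.succ)) :=
  measurePreserving_piFinSuccAbove μ 0

theorem measurable_fin_cons {n : ℕ} {Z : Fin (n + 1) → Type*} [∀ i, MeasurableSpace (Z i)] :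
    Measurable fun p : Z 0 × (∀ i : Fin n, Z i.succ) => (Fin.cons p.1 p.2 : ∀ i, Z i) :=
  measurable_pi_iff.2 <| Fin.cases measurable_fst fun i =>
    (measurable_pi_apply i).comp measurable_snd

theorem hasSubgaussianMGF_pi_of_update_le {n : ℕ} {Z : Fin n → Type*}
    [∀ i, MeasurableSpace (Z i)] {μ : ∀ i, Measure (Z i)} [∀ i, IsProbabilityMeasure (μ i)]
    {F : (∀ i, Z i) → ℝ} (hF : Measurable F) {c : Fin n → ℝ≥0}
    (hc : ∀ S i z, F (Function.update S i z) ≤ F S + c i) :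
    HasSubgaussianMGF (fun S => F S - ∫ T, F T ∂Measure.pi μ) (∑ i, (c i / 2) ^ 2)
      (Measure.pi μ) := by
  induction n with
  | zero =>
    have h S : F S = F default := congrArg F (Subsingleton.elim _ _)
    simp [h]
  | succ n ih =>
    set ν := Measure.pi fun i : Fin n => μ i.succ
    have hFm : Measurable fun p : Z 0 × (∀ i : Fin n, Z i.succ) => F (Fin.cons p.1 p.2) :=
      hF.comp measurable_fin_cons
    set G : Z 0 → ℝ := fun z => ∫ y, F (Fin.cons z y) ∂ν
    have hGm : Measurable G := hFm.stronglyMeasurable.integral_prod_right'.measurable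
    have htail z : HasSubgaussianMGF (fun y => F (Fin.cons z y) - G z)
        (∑ i : Fin n, (c i.succ / 2) ^ 2) ν :=
      ih (F := fun y => F (Fin.cons z y)) (hFm.comp measurable_prodMk_left) fun S i w => by
        simpa only [Fin.cons_update] using hc (Fin.cons z S) i.succ w
    have hint z : Integrable (fun y => F (Fin.cons z y)) ν :=
      integrable_add_const_iff.1 (htail z).integrable
    have hG z z' : G z ≤ G z' + c 0 := by
      have h := integral_mono (hint z) ((hint z').add (integrable_const (c 0 : ℝ))) fun y =>
        (Fin.update_cons_zero (α := Z) z' y z ▸ hc (Fin.cons z' y) 0 z :)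
      rwa [integral_add' (hint z') (integrable_const _), integral_const, probReal_univ, one_smul]
        at h
    have hprod : HasSubgaussianMGF (fun p => F (Fin.cons p.1 p.2) - ∫ z, G z ∂μ 0)
        (∑ i, (c i / 2) ^ 2) ((μ 0).prod ν) := by
      simpa [Fin.sum_univ_succ] using hasSubgaussianMGF_prod_add
        (hasSubgaussianMGF_sub_integral_of_forall_le_add (μ := μ 0) hGm hG)
        (hFm.sub (hGm.comp measurable_fst)) htail
    have hsplit := measurePreserving_head_tail μ
    have hFG : ∫ T, F T ∂Measure.pi μ = ∫ z, G z ∂μ 0 := by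
      rw [← integral_prod _ (integrable_add_const_iff.1 hprod.integrable), ← hsplit.map_eq,
        integral_map hsplit.aemeasurable hFm.aestronglyMeasurable]
      simp only [Fin.cons_self_tail]
    rw [← hsplit.map_eq] at hprod
    simpa only [hFG, Function.comp_def, Fin.cons_self_tail] using hprod.of_map hsplit.aemeasurable

end Concentration

section Symmetrization

theorem integrable_iSup_of_finite {Ω κ : Type*} [MeasurableSpace Ω] {μ : Measure Ω} [Finite κ]
    {f : κ → Ω → ℝ} (hf : ∀ k, Integrable (f k) μ) : Integrable (fun ω => ⨆ k, f k ω) μ := by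
  have := Fintype.ofFinite κ
  refine (integrable_finsetSum Finset.univ fun k _ => (hf k).abs).mono'
    (AEMeasurable.iSup fun k => (hf k).aemeasurable).aestronglyMeasurable (.of_forall fun ω => ?_)
  rcases isEmpty_or_nonempty κ with h | h
  · simp
  obtain ⟨k, hk⟩ := exists_eq_ciSup_of_finite (f := fun k => f k ω)
  rw [← hk]
  exact Finset.single_le_sum (f := fun k => |f k ω|) (fun _ _ => abs_nonneg _) (Finset.mem_univ k)

theorem integrable_comp_eval {ι α : Type*} [Fintype ι] [MeasurableSpace α] {μ : Measure α}
    [IsProbabilityMeasure μ] {f : α → ℝ} (hf : Integrable f μ) (i : ι) :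
    Integrable (fun S : ι → α => f (S i)) (Measure.pi fun _ => μ) :=
  (measurePreserving_eval (fun _ => μ) i).integrable_comp_of_integrable hf

theorem integral_sum_sub_const {ι α : Type*} [Fintype ι] [MeasurableSpace α] {μ : Measure α}
    [IsProbabilityMeasure μ] {f : α → ℝ} (hf : Integrable f μ) (c : ι → ℝ) :
    ∫ S : ι → α, ∑ i, (f (S i) - c i) ∂(Measure.pi fun _ => μ) = ∑ i, (∫ x, f x ∂μ - c i) := by
  have hi i : Integrable (fun S : ι → α => f (S i) - c i) (Measure.pi fun _ => μ) :=
    (integrable_comp_eval hf i).sub (integrable_const _)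
  rw [integral_finsetSum _ fun i _ => hi i]
  refine Finset.sum_congr rfl fun i _ => ?_
  rw [integral_sub (integrable_comp_eval hf i) (integrable_const _), integral_const, probReal_univ,
    one_smul, integral_comp_eval hf.aestronglyMeasurable]

variable {ι κ α : Type*} [Fintype ι] [Finite κ] [MeasurableSpace α] {μ : Measure α}
  [IsProbabilityMeasure μ] {φ : κ → α → ℝ}

theorem integrable_iSup_sum_signs (hφ : ∀ k, Integrable (φ k) μ) (s : ι → ℤˣ) :
    Integrable (fun S : ι → α => ⨆ k, (∑ i, s i • fun k => φ k (S i)) k)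
      (Measure.pi fun _ => μ) := by
  refine integrable_iSup_of_finite fun k => ?_
  simp only [sum_signs_smul_apply]
  exact integrable_finsetSum _ fun i _ => (integrable_comp_eval (hφ k) i).const_mul _

theorem integral_iSup_sum_sub_le_integral_ghost [Nonempty κ] (hφ : ∀ k, Integrable (φ k) μ) :
    ∫ S : ι → α, ⨆ k, ∑ i, (∫ x, φ k x ∂μ - φ k (S i)) ∂(Measure.pi fun _ => μ) ≤
      ∫ T : ι → α × α, ⨆ k, ∑ i, (φ k (T i).2 - φ k (T i).1) ∂(Measure.pi fun _ => μ.prod μ) := by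
  set P := Measure.pi fun _ : ι => μ
  have hterm k (S : ι → α) : Integrable (fun S' : ι → α => ∑ i, (φ k (S' i) - φ k (S i))) P :=
    integrable_finsetSum _ fun i _ => (integrable_comp_eval (hφ k) i).sub (integrable_const _)
  have hpair : Integrable (fun p : (ι → α) × (ι → α) => ⨆ k, ∑ i, (φ k (p.2 i) - φ k (p.1 i)))
      (P.prod P) :=
    integrable_iSup_of_finite fun k => integrable_finsetSum _ fun i _ =>
      ((integrable_comp_eval (hφ k) i).comp_snd P).sub ((integrable_comp_eval (hφ k) i).comp_fst P)
  have hsplit := measurePreserving_arrowProdEquivProdArrow α α ι (fun _ => μ) (fun _ => μ)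
  calc ∫ S, ⨆ k, ∑ i, (∫ x, φ k x ∂μ - φ k (S i)) ∂P
      ≤ ∫ S, ∫ S', ⨆ k, ∑ i, (φ k (S' i) - φ k (S i)) ∂P ∂P := by
        refine integral_mono (integrable_iSup_of_finite fun k => integrable_finsetSum _ fun i _ =>
          (integrable_const _).sub (integrable_comp_eval (hφ k) i)) hpair.integral_prod_left
          fun S => ciSup_le fun k => ?_
        rw [← integral_sum_sub_const (hφ k)]
        exact integral_mono (hterm k S) (integrable_iSup_of_finite fun k => hterm k S) fun S' =>
          le_ciSup (f := fun k => ∑ i, (φ k (S' i) - φ k (S i))) (Set.finite_range _).bddAbove k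
    _ = ∫ p, ⨆ k, ∑ i, (φ k (p.2 i) - φ k (p.1 i)) ∂P.prod P := (integral_prod _ hpair).symm
    _ = _ := (hsplit.integral_comp' _).symm

variable [DecidableEq ι]

theorem rademacherSum_sub_le [Nonempty κ] (b c : ι → κ → ℝ) :
    rademacherSum (b - c) ≤ rademacherSum b + rademacherSum c := by
  have hneg : rademacherSum c = 𝔼 s : ι → ℤˣ, ⨆ k, (∑ i, (-s) i • c i) k := by
    rw [rademacherSum]
    exact (Fintype.expect_equiv (Equiv.neg _) _ _ fun s => rfl).symm
  rw [hneg, rademacherSum, rademacherSum, ← Finset.expect_add_distrib]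
  refine Finset.expect_le_expect fun s _ => ciSup_le fun k => ?_
  refine le_trans (le_of_eq ?_) (add_le_add
    (le_ciSup (Set.finite_range (∑ i, s i • b i)).bddAbove k)
    (le_ciSup (Set.finite_range (∑ i, (-s) i • c i)).bddAbove k))
  simp [sub_eq_add_neg, Finset.sum_add_distrib]

theorem integral_rademacherSum (hφ : ∀ k, Integrable (φ k) μ) :
    ∫ S : ι → α, rademacherSum (fun i k => φ k (S i)) ∂(Measure.pi fun _ => μ) =
      𝔼 s : ι → ℤˣ, ∫ S : ι → α, ⨆ k, (∑ i, s i • fun k => φ k (S i)) k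
        ∂(Measure.pi fun _ => μ) := by
  simp only [rademacherSum, Fintype.expect_eq_sum_div_card]
  rw [integral_div, integral_finsetSum _ fun s _ => integrable_iSup_sum_signs hφ s]

theorem integrable_rademacherSum (hφ : ∀ k, Integrable (φ k) μ) :
    Integrable (fun S : ι → α => rademacherSum (fun i k => φ k (S i)))
      (Measure.pi fun _ => μ) := by
  simp only [rademacherSum, Fintype.expect_eq_sum_div_card]
  exact (integrable_finsetSum _ fun s _ => integrable_iSup_sum_signs hφ s).div_const _

theorem integral_iSup_sum_eq_integral_rademacherSum (hφ : ∀ k, Integrable (φ k) μ) {σ : α → α}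
    (hσ : MeasurePreserving σ μ μ) (hφσ : ∀ k x, φ k (σ x) = -φ k x) :
    ∫ S : ι → α, ⨆ k, ∑ i, φ k (S i) ∂(Measure.pi fun _ => μ) =
      ∫ S : ι → α, rademacherSum (fun i k => φ k (S i)) ∂(Measure.pi fun _ => μ) := by
  rw [integral_rademacherSum hφ]
  refine ((Finset.expect_congr rfl fun s _ => ?_).trans (Fintype.expect_const _)).symm
  have hflip : MeasurePreserving (fun (S : ι → α) i => if s i = 1 then S i else σ (S i))
      (Measure.pi fun _ => μ) (Measure.pi fun _ => μ) :=
    measurePreserving_pi (fun _ : ι => μ) (fun _ => μ)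
      (f := fun i x => if s i = 1 then x else σ x) fun i => by
        split_ifs
        exacts [.id μ, hσ]
  have hint : Integrable (fun S : ι → α => ⨆ k, ∑ i, φ k (S i)) (Measure.pi fun _ => μ) :=
    integrable_iSup_of_finite fun k =>
      integrable_finsetSum _ fun i _ => integrable_comp_eval (hφ k) i
  conv_rhs => rw [← hflip.map_eq]
  rw [integral_map hflip.aemeasurable (hflip.map_eq.symm ▸ hint.aestronglyMeasurable)]
  refine integral_congr_ae (.of_forall fun S => iSup_congr fun k => ?_)
  rw [sum_signs_smul_apply]
  refine Finset.sum_congr rfl fun i _ => ?_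
  rcases Int.units_eq_one_or (s i) with h | h <;> simp [h, hφσ]

theorem integral_rademacherSum_comp {β : Type*} [MeasurableSpace β] {ν : Measure β}
    [IsProbabilityMeasure ν] (hφ : ∀ k, Integrable (φ k) μ) {p : β → α}
    (hp : MeasurePreserving p ν μ) :
    ∫ T : ι → β, rademacherSum (fun i k => φ k (p (T i))) ∂(Measure.pi fun _ => ν) =
      ∫ S : ι → α, rademacherSum (fun i k => φ k (S i)) ∂(Measure.pi fun _ => μ) := by
  have hpi : MeasurePreserving (fun (T : ι → β) i => p (T i)) (Measure.pi fun _ => ν)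
      (Measure.pi fun _ => μ) := measurePreserving_pi _ _ fun _ => hp
  rw [← hpi.map_eq, integral_map hpi.aemeasurable
    (hpi.map_eq.symm ▸ (integrable_rademacherSum hφ).aestronglyMeasurable)]

theorem integral_iSup_sum_integral_sub_le [Nonempty κ] (hφ : ∀ k, Integrable (φ k) μ) :
    ∫ S : ι → α, ⨆ k, ∑ i, (∫ x, φ k x ∂μ - φ k (S i)) ∂(Measure.pi fun _ => μ) ≤
      2 * ∫ S : ι → α, rademacherSum (fun i k => φ k (S i)) ∂(Measure.pi fun _ => μ) := by
  have hfst k : Integrable (fun w : α × α => φ k w.1) (μ.prod μ) := (hφ k).comp_fst μ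
  have hsnd k : Integrable (fun w : α × α => φ k w.2) (μ.prod μ) := (hφ k).comp_snd μ
  have hdiff k : Integrable (fun w : α × α => φ k w.2 - φ k w.1) (μ.prod μ) :=
    (hsnd k).sub (hfst k)
  have hRfst := integrable_rademacherSum (ι := ι) hfst
  have hRsnd := integrable_rademacherSum (ι := ι) hsnd
  have hle (T : ι → α × α) : rademacherSum (fun i k => φ k (T i).2 - φ k (T i).1) ≤
      rademacherSum (fun i k => φ k (T i).2) + rademacherSum fun i k => φ k (T i).1 :=
    rademacherSum_sub_le (fun i k => φ k (T i).2) fun i k => φ k (T i).1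
  calc _ ≤ ∫ T : ι → α × α, ⨆ k, ∑ i, (φ k (T i).2 - φ k (T i).1)
          ∂(Measure.pi fun _ => μ.prod μ) := integral_iSup_sum_sub_le_integral_ghost hφ
    _ = ∫ T : ι → α × α, rademacherSum (fun i k => φ k (T i).2 - φ k (T i).1)
          ∂(Measure.pi fun _ => μ.prod μ) :=
        integral_iSup_sum_eq_integral_rademacherSum hdiff Measure.measurePreserving_swap
          fun k w => by simp
    _ ≤ ∫ T : ι → α × α, (rademacherSum (fun i k => φ k (T i).2) +
          rademacherSum fun i k => φ k (T i).1) ∂(Measure.pi fun _ => μ.prod μ) :=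
        integral_mono (integrable_rademacherSum hdiff) (hRsnd.add hRfst) hle
    _ = _ := by
        rw [integral_add hRsnd hRfst,
          integral_rademacherSum_comp hφ measurePreserving_snd,
          integral_rademacherSum_comp hφ measurePreserving_fst, two_mul]

end Symmetrization

section PointwiseSeparable

/-- A class of functions is pointwise separable if it has a countable subclass from which every
member can be reached as a pointwise limit of a sequence. Suprema over such a class behave, up to
null sets, like suprema over a countable class. -/
def PointwiseSeparable {α : Type*} (𝓛 : Set (α → ℝ)) : Prop :=
  ∃ 𝓠 ⊆ 𝓛, 𝓠.Countable ∧
    ∀ ψ ∈ 𝓛, ∃ q : ℕ → α → ℝ, (∀ m, q m ∈ 𝓠) ∧ ∀ x, Tendsto (q · x) atTop (𝓝 (ψ x))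

theorem PointwiseSeparable.exists_seq {α : Type*} {𝓛 : Set (α → ℝ)} (h : PointwiseSeparable 𝓛)
    (hne : 𝓛.Nonempty) :
    ∃ e : ℕ → α → ℝ, (∀ m, e m ∈ 𝓛) ∧
      ∀ ψ ∈ 𝓛, ∃ g : ℕ → ℕ, ∀ x, Tendsto (fun j => e (g j) x) atTop (𝓝 (ψ x)) := by
  obtain ⟨𝓠, hsub, hcount, hlim⟩ := h
  have h𝓠 : 𝓠.Nonempty := by
    obtain ⟨ψ, hψ⟩ := hne
    obtain ⟨q, hq, -⟩ := hlim ψ hψ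
    exact ⟨q 0, hq 0⟩
  obtain ⟨e, rfl⟩ := hcount.exists_eq_range h𝓠
  refine ⟨e, fun m => hsub ⟨m, rfl⟩, fun ψ hψ => ?_⟩
  obtain ⟨q, hq, hqψ⟩ := hlim ψ hψ
  choose g hg using hq
  exact ⟨g, by simpa only [hg] using hqψ⟩

theorem pointwiseSeparable_of_forall_continuous {X : Type*} [TopologicalSpace X]
    [SecondCountableTopology X] [LocallyCompactSpace X] {𝓕 : Set (X → ℝ)}
    (h : ∀ f ∈ 𝓕, Continuous f) : PointwiseSeparable 𝓕 := by
  set 𝓒 : Set C(X, ℝ) := {g | ⇑g ∈ 𝓕}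
  obtain ⟨t, hcount, hdense⟩ := TopologicalSpace.exists_countable_dense 𝓒
  refine ⟨(fun g : 𝓒 => ⇑g.1) '' t, ?_, hcount.image _, fun f hf => ?_⟩
  · rintro _ ⟨g, -, rfl⟩
    exact g.2
  obtain ⟨v, hv, hlim⟩ := mem_closure_iff_seq_limit.1 (hdense ⟨⟨f, h f hf⟩, hf⟩)
  exact ⟨fun m => v m, fun m => ⟨v m, hv m, rfl⟩, fun x =>
    (((continuous_eval_const x).comp continuous_subtype_val).tendsto _).comp hlim⟩

theorem PointwiseSeparable.image {X α : Type*} {𝓕 : Set (X → ℝ)} (h : PointwiseSeparable 𝓕)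
    {T : (X → ℝ) → α → ℝ} (hT : ∀ {q : ℕ → X → ℝ} {f : X → ℝ},
      (∀ x, Tendsto (q · x) atTop (𝓝 (f x))) →
        ∀ a, Tendsto (fun m => T (q m) a) atTop (𝓝 (T f a))) :
    PointwiseSeparable (T '' 𝓕) := by
  obtain ⟨𝓠, hsub, hcount, hlim⟩ := h
  refine ⟨T '' 𝓠, Set.image_mono hsub, hcount.image T, Set.forall_mem_image.2 fun f hf => ?_⟩
  obtain ⟨q, hq, hqf⟩ := hlim f hf
  exact ⟨fun m => T (q m), fun m => ⟨q m, hq m, rfl⟩, hT hqf⟩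

end PointwiseSeparable

section UniformDeviation

theorem iSup_sum_sub_update_le {α ι κ : Type*} [Fintype ι] [DecidableEq ι] [Finite κ]
    [Nonempty κ] {ψ : κ → α → ℝ} (hψ : ∀ k x, ψ k x ∈ Set.Icc 0 1) (a : κ → ℝ)
    (S : ι → α) (i : ι) (x : α) :
    ⨆ k, ∑ j, (a k - ψ k (Function.update S i x j)) ≤ (⨆ k, ∑ j, (a k - ψ k (S j))) + 1 := by
  refine ciSup_le fun k => ?_
  have hle := le_ciSup (f := fun k => ∑ j, (a k - ψ k (S j))) (Set.finite_range _).bddAbove k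
  have herase : ∑ j ∈ Finset.univ.erase i, ψ k (Function.update S i x j) =
      ∑ j ∈ Finset.univ.erase i, ψ k (S j) :=
    Finset.sum_congr rfl fun j hj => by rw [Function.update_of_ne (Finset.ne_of_mem_erase hj)]
  have hsum : ∑ j, ψ k (S j) ≤ ∑ j, ψ k (Function.update S i x j) + 1 := by
    rw [← Finset.add_sum_erase _ _ (Finset.mem_univ i),
      ← Finset.add_sum_erase _ (fun j => ψ k (Function.update S i x j)) (Finset.mem_univ i),
      Function.update_self, herase]
    linarith [(hψ k x).1, (hψ k (S i)).2]
  simp only [Finset.sum_sub_distrib] at hle ⊢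
  linarith

variable {α : Type*} [MeasurableSpace α] {μ : Measure α} [IsProbabilityMeasure μ]
  {𝓛 : Set (α → ℝ)} {n : ℕ} {r u : ℝ}

theorem measure_add_le_le_of_update_le {F : (Fin n → α) → ℝ} (hF : Measurable F)
    (hF1 : ∀ S i x, F (Function.update S i x) ≤ F S + 1) (hu : 0 ≤ u) :
    (Measure.pi fun _ => μ) {S | ∫ T, F T ∂(Measure.pi fun _ => μ) + n * u ≤ F S} ≤
      ENNReal.ofReal (exp (-2 * n * u ^ 2)) := by
  have h := (hasSubgaussianMGF_pi_of_update_le (μ := fun _ => μ) (c := fun _ => 1) hF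
    (by simpa using hF1)).measure_ge_le (ε := n * u) (by positivity)
  have hexp : -(n * u) ^ 2 / (2 * ((∑ _ : Fin n, ((1 : ℝ≥0) / 2) ^ 2 : ℝ≥0) : ℝ)) =
      -2 * n * u ^ 2 := by
    rcases Nat.eq_zero_or_pos n with rfl | hn
    · simp
    · simp only [Finset.sum_const, Finset.card_fin, nsmul_eq_mul]
      push_cast
      field_simp
  rw [hexp, measureReal_def] at h
  simp only [le_sub_iff_add_le'] at h
  exact (ENNReal.le_ofReal_iff_toReal_le (measure_ne_top _ _) (exp_pos _).le).2 h

theorem measure_exists_sum_add_lt_integral_le {κ : Type*} [Finite κ] {ψ : κ → α → ℝ}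
    (hψ : ∀ k, Measurable (ψ k)) (hψ1 : ∀ k x, ψ k x ∈ Set.Icc 0 1) (hu : 0 ≤ u)
    (hr : ∀ᵐ S ∂(Measure.pi fun _ : Fin n => μ), rademacherSum (fun i k => ψ k (S i)) ≤ n * r) :
    (Measure.pi fun _ : Fin n => μ)
      {S | ∃ k, ∑ i, ψ k (S i) + n * (2 * r + u) < n * ∫ x, ψ k x ∂μ} ≤
      ENNReal.ofReal (exp (-2 * n * u ^ 2)) := by
  rcases isEmpty_or_nonempty κ with hκ | hκ
  · simp
  set P := Measure.pi fun _ : Fin n => μ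
  set Φ : (Fin n → α) → ℝ := fun S => ⨆ k, ∑ i, (∫ x, ψ k x ∂μ - ψ k (S i))
  have hint k : Integrable (ψ k) μ :=
    .of_mem_Icc 0 1 (hψ k).aemeasurable (.of_forall (hψ1 k))
  have hΦm : Measurable Φ := Measurable.iSup fun k =>
    Finset.measurable_sum _ fun i _ => ((hψ k).comp (measurable_pi_apply i)).const_sub _
  have hmean : ∫ S, Φ S ∂P ≤ n * (2 * r) := by
    have := integral_mono_ae (integrable_rademacherSum hint) (integrable_const (n * r)) hr
    rw [integral_const, probReal_univ, one_smul] at this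
    linarith [integral_iSup_sum_integral_sub_le (ι := Fin n) hint]
  refine le_trans (measure_mono ?_) (measure_add_le_le_of_update_le hΦm
    (iSup_sum_sub_update_le hψ1 fun k => ∫ x, ψ k x ∂μ) hu)
  rintro S ⟨k, hk⟩
  have hle : ∑ i, (∫ x, ψ k x ∂μ - ψ k (S i)) ≤ Φ S :=
    le_ciSup (f := fun k => ∑ i, (∫ x, ψ k x ∂μ - ψ k (S i))) (Set.finite_range _).bddAbove k
  rw [Finset.sum_sub_distrib, Finset.sum_const, Finset.card_fin, nsmul_eq_mul] at hle
  simp only [Set.mem_ofPred_eq]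
  linarith

theorem exists_sum_add_lt_integral_of_tendsto {ι : Type*} [Fintype ι] {a b : ℝ} {q : ℕ → α → ℝ}
    {ψ : α → ℝ} (hq : ∀ m, Measurable (q m)) (hq1 : ∀ m x, q m x ∈ Set.Icc 0 1)
    (hqψ : ∀ x, Tendsto (q · x) atTop (𝓝 (ψ x))) {S : ι → α}
    (h : ∑ i, ψ (S i) + a < b * ∫ x, ψ x ∂μ) :
    ∃ m, ∑ i, q m (S i) + a < b * ∫ x, q m x ∂μ := by
  have hint : Tendsto (fun m => ∫ x, q m x ∂μ) atTop (𝓝 (∫ x, ψ x ∂μ)) := by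
    refine tendsto_integral_of_dominated_convergence (fun _ => 1)
      (fun m => (hq m).aestronglyMeasurable) (integrable_const 1)
      (fun m => .of_forall fun x => ?_) (.of_forall hqψ)
    rw [norm_of_nonneg (hq1 m x).1]
    exact (hq1 m x).2
  have hsum : Tendsto (fun m => ∑ i, q m (S i) + a) atTop (𝓝 (∑ i, ψ (S i) + a)) :=
    (tendsto_finsetSum _ fun i _ => hqψ (S i)).add_const a
  exact (hsum.eventually_lt (hint.const_mul b) h).exists

theorem measure_exists_mem_sum_add_lt_integral_le (hsep : PointwiseSeparable 𝓛)
    (hm : ∀ ψ ∈ 𝓛, Measurable ψ) (h1 : ∀ ψ ∈ 𝓛, ∀ x, ψ x ∈ Set.Icc 0 1) (hu : 0 ≤ u)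
    (hr : ∀ (N : ℕ) (ψ : Fin N → α → ℝ), (∀ k, ψ k ∈ 𝓛) →
      ∀ᵐ S ∂(Measure.pi fun _ : Fin n => μ), rademacherSum (fun i k => ψ k (S i)) ≤ n * r) :
    (Measure.pi fun _ : Fin n => μ)
      {S | ∃ ψ ∈ 𝓛, ∑ i, ψ (S i) + n * (2 * r + u) < n * ∫ x, ψ x ∂μ} ≤
      ENNReal.ofReal (exp (-2 * n * u ^ 2)) := by
  rcases 𝓛.eq_empty_or_nonempty with rfl | hne
  · simp
  obtain ⟨e, he, hlim⟩ := hsep.exists_seq hne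
  set A : ℕ → Set (Fin n → α) := fun N =>
    {S | ∃ k : Fin N, ∑ i, e k (S i) + n * (2 * r + u) < n * ∫ x, e k x ∂μ}
  have hA : Monotone A := fun N M hNM S ⟨k, hk⟩ => ⟨k.castLE hNM, hk⟩
  have hsub : {S | ∃ ψ ∈ 𝓛, ∑ i, ψ (S i) + n * (2 * r + u) < n * ∫ x, ψ x ∂μ} ⊆ ⋃ N, A N := by
    rintro S ⟨ψ, hψ, hS⟩
    obtain ⟨g, hg⟩ := hlim ψ hψ
    obtain ⟨m, hm⟩ := exists_sum_add_lt_integral_of_tendsto (fun m => hm _ (he (g m)))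
      (fun m => h1 _ (he (g m))) hg hS
    exact Set.mem_iUnion.2 ⟨g m + 1, Fin.last _, hm⟩
  refine (measure_mono hsub).trans ?_
  rw [hA.measure_iUnion]
  exact iSup_le fun N => measure_exists_sum_add_lt_integral_le (fun k => hm _ (he k))
    (fun k => h1 _ (he k)) hu (hr N (fun k => e k) fun k => he k)

end UniformDeviation

section ProductMeasure

theorem measure_pi_comp_equiv {ι ι' α : Type*} [Fintype ι] [Fintype ι'] [MeasurableSpace α]
    (μ : Measure α) [SigmaFinite μ] (e : ι ≃ ι') (s : Set (ι → α)) :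
    (Measure.pi fun _ : ι' => μ) {S | S ∘ e ∈ s} = (Measure.pi fun _ : ι => μ) s := by
  rw [← (measurePreserving_piCongrLeft (fun _ => μ) e.symm).measure_preimage_equiv]
  congr 1
  ext S
  simp only [Set.mem_preimage, Set.mem_ofPred_eq]
  rw [show MeasurableEquiv.piCongrLeft (fun _ => α) e.symm S = S ∘ e from
    funext fun i => by simp [MeasurableEquiv.piCongrLeft, Equiv.piCongrLeft_apply]]

theorem ae_pi_forall {ι α : Type*} [Fintype ι] [MeasurableSpace α] {μ : Measure α}
    [IsProbabilityMeasure μ] {p : α → Prop} (h : ∀ᵐ x ∂μ, p x) :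
    ∀ᵐ S ∂(Measure.pi fun _ : ι => μ), ∀ i, p (S i) :=
  ae_all_iff.2 fun i => (measurePreserving_eval (fun _ => μ) i).quasiMeasurePreserving.ae h

end ProductMeasure

section Ramp

/-- The ramp function: `1` on `(-∞, 0]`, `0` on `[1, ∞)` and linear in between. It is the
`1`-Lipschitz surrogate lying between the indicator functions of `t < 0` and of `t < 1`. -/
def ramp (t : ℝ) : ℝ := max 0 (min 1 (1 - t))

theorem ramp_mem_Icc (t : ℝ) : ramp t ∈ Set.Icc 0 1 :=
  ⟨le_max_left _ _, max_le zero_le_one (min_le_left _ _)⟩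

theorem ramp_of_nonpos {t : ℝ} (ht : t ≤ 0) : ramp t = 1 := by
  rw [ramp, min_eq_left (by linarith), max_eq_right zero_le_one]

theorem ramp_of_one_le {t : ℝ} (ht : 1 ≤ t) : ramp t = 0 := by
  rw [ramp, min_eq_right (by linarith), max_eq_left (by linarith)]

theorem continuous_ramp : Continuous ramp := by
  unfold ramp
  fun_prop

theorem abs_ramp_sub_ramp_le (a b : ℝ) : |ramp a - ramp b| ≤ |a - b| := by
  calc |ramp a - ramp b| ≤ |min 1 (1 - a) - min 1 (1 - b)| := by
        simpa only [ramp, max_comm (0 : ℝ)] using abs_max_sub_max_le_abs _ _ (0 : ℝ)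
    _ ≤ |(1 - a) - (1 - b)| := by
        simpa only [min_comm (1 : ℝ)] using abs_inf_sub_inf_le_abs (1 - a) (1 - b) 1
    _ = |a - b| := by rw [sub_sub_sub_cancel_left, abs_sub_comm]

end Ramp

section RampLoss

variable {dP dA l n : ℕ} {R : ℕ → ℝ} {D : Measure (LabeledInstance dP dA)}

/-- The input of an instance, scaled to the unit sphere; a zero input stays zero. -/
def unitInput (z : LabeledInstance dP dA) : EuclideanSpace ℝ (Fin dP ⊕ Fin dA) :=
  ‖input z‖⁻¹ • input z

/-- The ramp loss of `f` at margin `ρ` on the scaled input. Scaling makes the loss class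
independent of the size of the sample points. -/
def rampLoss (ρ : ℝ) (f : EuclideanSpace ℝ (Fin dP ⊕ Fin dA) → ℝ)
    (z : LabeledInstance dP dA) : ℝ :=
  ramp (label z * (ρ⁻¹ * f (unitInput z)))

theorem norm_unitInput_le (z : LabeledInstance dP dA) : ‖unitInput z‖ ≤ 1 := by
  rw [unitInput, norm_smul, norm_inv, norm_norm]
  exact inv_mul_le_one

theorem measurable_input : Measurable (input : LabeledInstance dP dA → _) := by
  refine (WithLp.measurable_toLp 2 _).comp (measurable_pi_iff.2 fun i => ?_)
  cases i with
  | inl i => simp only [Sum.elim_inl]; fun_prop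
  | inr i => simp only [Sum.elim_inr]; fun_prop

theorem measurable_label : Measurable (label : LabeledInstance dP dA → ℝ) :=
  measurable_snd.comp measurable_snd

theorem measurable_rampLoss (ρ : ℝ) {f : EuclideanSpace ℝ (Fin dP ⊕ Fin dA) → ℝ}
    (hf : Continuous f) : Measurable (rampLoss ρ f) :=
  continuous_ramp.measurable.comp (measurable_label.mul
    ((hf.measurable.comp (measurable_input.norm.inv.smul measurable_input)).const_mul ρ⁻¹))

theorem rademacherSum_rampLoss_le {κ : Type*} [Finite κ] (hl : 1 ≤ l) (hn : 0 < n)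
    (hR : ∀ i ∈ Finset.Icc 1 l, 0 ≤ R i) (hΓ : 0 < gammaF l R)
    {f : κ → EuclideanSpace ℝ (Fin dP ⊕ Fin dA) → ℝ}
    (hf : ∀ k, f k ∈ networkClass (Fin dP ⊕ Fin dA) l R) {ρ : ℝ} (hρ : 0 ≤ ρ)
    {S : Fin n → LabeledInstance dP dA} (hS : ∀ i, |label (S i)| ≤ 1) :
    rademacherSum (fun i k => rampLoss ρ (f k) (S i)) ≤
      n * (2 * (gammaF l R / ρ) * √(l / n)) := by
  calc rademacherSum (fun i k => rampLoss ρ (f k) (S i))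
      ≤ rademacherSum (fun i k => ρ⁻¹ * f k (unitInput (S i))) := by
        refine rademacherSum_le_of_abs_sub_le fun i k k' => (abs_ramp_sub_ramp_le _ _).trans ?_
        rw [← mul_sub, abs_mul]
        exact mul_le_of_le_one_left (abs_nonneg _) (hS i)
    _ = ρ⁻¹ * rademacherSum (fun i k => f k (unitInput (S i))) :=
        rademacherSum_const_mul (inv_nonneg.2 hρ) _
    _ ≤ ρ⁻¹ * (2 * gammaF l R * (n * √(l / n))) := by
        gcongr
        exact rademacherSum_networkClass_le hl hn hR hΓ hf fun i => norm_unitInput_le (S i)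
    _ = n * (2 * (gammaF l R / ρ) * √(l / n)) := by ring

theorem pointwiseSeparable_rampLoss (hl : 1 ≤ l) (ρ : ℝ) :
    PointwiseSeparable
      (rampLoss (dP := dP) (dA := dA) ρ '' networkClass (Fin dP ⊕ Fin dA) l R) :=
  PointwiseSeparable.image
    (pointwiseSeparable_of_forall_continuous fun _ hf => continuous_of_mem_networkClass hl hf)
    fun hq z => (continuous_ramp.tendsto _).comp (((hq (unitInput z)).const_mul _).const_mul _)

theorem measure_sum_rampLoss_add_lt_integral_le [IsProbabilityMeasure D] (hl : 1 ≤ l) (hn : 0 < n)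
    (hD : ∀ᵐ z ∂D, |label z| ≤ 1) (hR : ∀ i ∈ Finset.Icc 1 l, 0 ≤ R i) (hΓ : 0 < gammaF l R)
    {ρ u : ℝ} (hρ : 0 ≤ ρ) (hu : 0 ≤ u) :
    Measure.pi (fun _ : Fin n => D)
      {S | ∃ f ∈ networkClass (Fin dP ⊕ Fin dA) l R, ∑ i, rampLoss ρ f (S i) +
        n * (2 * (2 * (gammaF l R / ρ) * √(l / n)) + u) < n * ∫ z, rampLoss ρ f z ∂D} ≤
      ENNReal.ofReal (exp (-2 * n * u ^ 2)) := by
  have h := measure_exists_mem_sum_add_lt_integral_le (μ := D) (n := n)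
    (r := 2 * (gammaF l R / ρ) * √(l / n)) (pointwiseSeparable_rampLoss (R := R) hl ρ)
    (Set.forall_mem_image.2 fun f hf =>
      measurable_rampLoss ρ (continuous_of_mem_networkClass hl hf))
    (Set.forall_mem_image.2 fun f _ z => ramp_mem_Icc _) hu fun N ψ hψ => by
      choose f hf hfψ using hψ
      filter_upwards [ae_pi_forall hD] with S hS
      simpa only [hfψ] using rademacherSum_rampLoss_le hl hn hR hΓ hf hρ hS
  simpa only [Set.exists_mem_image] using h

theorem exp_neg_two_mul_deviation_sq_le (hl : 1 ≤ l) (hn : 0 < n) {δ : ℝ} (hδ : 0 < δ) (j : ℕ) :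
    exp (-2 * n * (2 ^ j * √(l / n) + √(log (1 / δ) / n)) ^ 2) ≤ δ / 2 / 2 ^ j := by
  have hl' : (1 : ℝ) ≤ l := by exact_mod_cast hl
  have hpow : (1 : ℝ) ≤ 2 ^ j := one_le_pow₀ one_le_two
  have hwidth : (2 : ℝ) ^ j ≤ n * (2 ^ j * √(l / n)) ^ 2 := by
    rw [mul_pow, sq_sqrt (by positivity), show n * ((2 ^ j) ^ 2 * (l / n : ℝ)) = 2 ^ j * (2 ^ j * l)
      by field_simp]
    exact le_mul_of_one_le_right (by positivity) (one_le_mul_of_one_le_of_one_le hpow hl')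
  have hlog : log (1 / δ) ≤ n * √(log (1 / δ) / n) ^ 2 := by
    rw [sq_sqrt']
    calc log (1 / δ) = n * (log (1 / δ) / n) := by field_simp
      _ ≤ n * max (log (1 / δ) / n) 0 := by gcongr; exact le_max_left _ _
  have hsq : n * (2 ^ j * √(l / n)) ^ 2 + n * √(log (1 / δ) / n) ^ 2 ≤
      n * (2 ^ j * √(l / n) + √(log (1 / δ) / n)) ^ 2 := by
    rw [← mul_add, add_sq]
    gcongr
    have : 0 ≤ 2 * (2 ^ j * √(l / n : ℝ)) * √(log (1 / δ) / n) := by positivity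
    linarith
  calc exp (-2 * n * (2 ^ j * √(l / n) + √(log (1 / δ) / n)) ^ 2)
      ≤ exp (-log (1 / δ) + -(2 * 2 ^ j)) := by
        refine exp_le_exp.2 ?_
        have : 0 ≤ n * √(log (1 / δ) / n) ^ 2 := by positivity
        linarith
    _ = δ * (exp (2 * 2 ^ j))⁻¹ := by
        rw [exp_add, exp_neg (2 * 2 ^ j), one_div, log_inv, neg_neg, exp_log hδ]
    _ ≤ δ * (2 * 2 ^ j)⁻¹ := by
        gcongr
        linarith [add_one_le_exp ((2 : ℝ) * 2 ^ j)]
    _ = δ / 2 / 2 ^ j := by field_simp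

theorem measure_exists_sum_rampLoss_add_lt_integral_le [IsProbabilityMeasure D] (hl : 1 ≤ l)
    (hn : 0 < n) (hD : ∀ᵐ z ∂D, |label z| ≤ 1) (hR : ∀ i ∈ Finset.Icc 1 l, 0 ≤ R i)
    (hΓ : 0 < gammaF l R) {δ : ℝ} (hδ : 0 < δ) :
    Measure.pi (fun _ : Fin n => D)
      {S | ∃ j : ℕ, ∃ f ∈ networkClass (Fin dP ⊕ Fin dA) l R,
        ∑ i, rampLoss (gammaF l R / 2 ^ j) f (S i) +
          n * (2 ^ j * (5 * √(l / n)) + √(log (1 / δ) / n)) <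
            n * ∫ z, rampLoss (gammaF l R / 2 ^ j) f z ∂D} ≤ ENNReal.ofReal δ := by
  have hgeom := hasSum_geometric_two' δ
  have hsum : ∑' j : ℕ, ENNReal.ofReal (δ / 2 / 2 ^ j) = ENNReal.ofReal δ := by
    rw [← ENNReal.ofReal_tsum_of_nonneg (fun j => by positivity) hgeom.summable, hgeom.tsum_eq]
  rw [Set.ofPred_exists, ← hsum]
  refine (measure_iUnion_le _).trans (ENNReal.tsum_le_tsum fun j => ?_)
  have h := measure_sum_rampLoss_add_lt_integral_le hl hn hD hR hΓ (ρ := gammaF l R / 2 ^ j)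
    (u := 2 ^ j * √(l / n) + √(log (1 / δ) / n)) (by positivity) (by positivity)
  rw [div_div_cancel₀ hΓ.ne', show 2 * (2 * 2 ^ j * √(l / n : ℝ)) +
    (2 ^ j * √(l / n) + √(log (1 / δ) / n)) =
      2 ^ j * (5 * √(l / n)) + √(log (1 / δ) / n) by ring] at h
  exact h.trans (ENNReal.ofReal_le_ofReal (exp_neg_two_mul_deviation_sq_le hl hn hδ j))

theorem measure_exists_average_rampLoss_add_lt_integral_le {ι : Type*} [Fintype ι] [Nonempty ι]
    [IsProbabilityMeasure D] (hl : 1 ≤ l) (hD : ∀ᵐ z ∂D, |label z| ≤ 1)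
    (hR : ∀ i ∈ Finset.Icc 1 l, 0 ≤ R i) (hΓ : 0 < gammaF l R) {δ : ℝ} (hδ : 0 < δ) :
    Measure.pi (fun _ : ι => D)
      {S | ∃ j : ℕ, ∃ f ∈ networkClass (Fin dP ⊕ Fin dA) l R,
        (∑ i, rampLoss (gammaF l R / 2 ^ j) f (S i)) / Fintype.card ι +
          (2 ^ j * (5 * √(l / Fintype.card ι)) + √(log (1 / δ) / Fintype.card ι)) <
            ∫ z, rampLoss (gammaF l R / 2 ^ j) f z ∂D} ≤ ENNReal.ofReal δ := by
  have hcard : (0 : ℝ) < Fintype.card ι := by exact_mod_cast Fintype.card_pos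
  refine le_trans (measure_mono ?_) ((measure_pi_comp_equiv D (Fintype.equivFin ι).symm _).trans_le
    (measure_exists_sum_rampLoss_add_lt_integral_le hl Fintype.card_pos hD hR hΓ hδ))
  rintro S ⟨j, f, hf, h⟩
  refine ⟨j, f, hf, ?_⟩
  simp only [Function.comp_apply,
    (Fintype.equivFin ι).symm.sum_comp fun i => rampLoss (gammaF l R / 2 ^ j) f (S i)]
  rw [← mul_lt_mul_iff_right₀ hcard, mul_add, mul_div_cancel₀ _ hcard.ne'] at h
  exact h

end RampLoss

section Errors

variable {dP dA nP nA : ℕ} {f : EuclideanSpace ℝ (Fin dP ⊕ Fin dA) → ℝ}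
  {z : LabeledInstance dP dA} {S : Fin nP × Fin nA → LabeledInstance dP dA} {γ ρ Γ a b : ℝ}
  {D : Measure (LabeledInstance dP dA)}

theorem label_mul_inv_mul_apply_unitInput (hsmul : ∀ c ≥ 0, ∀ x, f (c • x) = c * f x) :
    label z * (ρ⁻¹ * f (unitInput z)) = label z * f (input z) / (ρ * ‖input z‖) := by
  rw [unitInput, hsmul _ (inv_nonneg.2 (norm_nonneg _)), div_eq_mul_inv, mul_inv]
  ring

theorem testError_le_integral_rampLoss [IsProbabilityMeasure D] (hf : Continuous f)
    (hsmul : ∀ c ≥ 0, ∀ x, f (c • x) = c * f x) (hρ : 0 ≤ ρ) :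
    testError D f ≤ ∫ z, rampLoss ρ f z ∂D := by
  have hmeas : MeasurableSet {z : LabeledInstance dP dA | label z * f (input z) < 0} :=
    measurableSet_lt (measurable_label.mul (hf.measurable.comp measurable_input)) measurable_const
  rw [testError, ← integral_indicator_one hmeas]
  refine integral_mono ((integrable_const (1 : ℝ)).indicator hmeas)
    (.of_mem_Icc 0 1 (measurable_rampLoss ρ hf).aemeasurable (.of_forall fun z => ramp_mem_Icc _))
    (Set.indicator_le' (fun z hz => ?_) fun z _ => (ramp_mem_Icc _).1)
  refine (ramp_of_nonpos ?_).ge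
  rw [label_mul_inv_mul_apply_unitInput hsmul]
  exact div_nonpos_of_nonpos_of_nonneg (le_of_lt hz) (by positivity)

theorem rampLoss_eq_zero (hsmul : ∀ c ≥ 0, ∀ x, f (c • x) = c * f x) (hρ : 0 < ρ) (hγ : 0 < γ)
    (hz : ρ * ‖input z‖ ≤ γ) (h : γ ≤ label z * f (input z)) : rampLoss ρ f z = 0 := by
  have hinput : 0 < ‖input z‖ := by
    rw [norm_pos_iff]
    intro h0
    have hf0 : f 0 = 0 := by simpa using hsmul 0 le_rfl 0
    rw [h0, hf0, mul_zero] at h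
    exact hγ.not_ge h
  apply ramp_of_one_le
  rw [label_mul_inv_mul_apply_unitInput hsmul, le_div_iff₀ (by positivity), one_mul]
  exact hz.trans h

theorem norm_input_le_sqrt_gammaS (S : Fin nP × Fin nA → LabeledInstance dP dA) (i) :
    ‖input (S i)‖ ≤ √(gammaS S) :=
  le_sqrt_of_sq_le (le_ciSup (f := fun i => ‖input (S i)‖ ^ 2) (Set.finite_range _).bddAbove i)

theorem sum_rampLoss_div_le_empiricalError (hsmul : ∀ c ≥ 0, ∀ x, f (c • x) = c * f x)
    (hρ : 0 < ρ) (hγ : 0 < γ) (hργ : ρ * √(gammaS S) ≤ γ) :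
    (∑ i, rampLoss ρ f (S i)) / (nP * nA) ≤ empiricalError S γ f := by
  classical
  rw [empiricalError, Set.ncard_eq_toFinset_card', Set.toFinset_ofPred, Finset.card_filter,
    Nat.cast_sum]
  gcongr with i
  split_ifs with h
  · rw [Nat.cast_one]
    exact (ramp_mem_Icc _).2
  · rw [Nat.cast_zero, rampLoss_eq_zero hsmul hρ hγ _ (not_lt.1 h)]
    exact le_trans (by gcongr; exact norm_input_le_sqrt_gammaS S i) hργ

theorem empiricalError_eq_one (hP : 1 ≤ nP) (hA : 1 ≤ nA) (hΓ : 0 ≤ Γ)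
    (hf : ∀ x, |f x| ≤ Γ * ‖x‖) (hS : ∀ i, |label (S i)| ≤ 1) (hγ : Γ * √(gammaS S) < γ) :
    empiricalError S γ f = 1 := by
  have hall : {i | label (S i) * f (input (S i)) < γ} = Set.univ := by
    refine Set.eq_univ_of_forall fun i => lt_of_le_of_lt ?_ hγ
    calc label (S i) * f (input (S i)) ≤ |label (S i)| * |f (input (S i))| := by
          rw [← abs_mul]
          exact le_abs_self _
      _ ≤ 1 * (Γ * √(gammaS S)) := by
          gcongr
          · exact hS i
          · exact (hf _).trans (by gcongr; exact norm_input_le_sqrt_gammaS S i)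
      _ = Γ * √(gammaS S) := one_mul _
  rw [empiricalError, hall, Set.ncard_univ, Nat.card_prod, Nat.card_fin, Nat.card_fin,
    Nat.cast_mul, div_self (by positivity)]

theorem testError_le_of_rampLoss_deviation [IsProbabilityMeasure D] (hP : 1 ≤ nP) (hA : 1 ≤ nA)
    (hf : Continuous f) (hsmul : ∀ c ≥ 0, ∀ x, f (c • x) = c * f x) (hΓ : 0 < Γ)
    (hfΓ : ∀ x, |f x| ≤ Γ * ‖x‖) (hS : ∀ i, |label (S i)| ≤ 1) (ha : 0 ≤ a) (hb : 0 ≤ b)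
    (hdev : ∀ j : ℕ, ∫ z, rampLoss (Γ / 2 ^ j) f z ∂D ≤
      (∑ i, rampLoss (Γ / 2 ^ j) f (S i)) / (nP * nA) + (2 ^ j * a + b)) (hγ : 0 < γ) :
    testError D f ≤ empiricalError S γ f + 2 * (Γ * √(gammaS S) / γ) * a + b := by
  rcases lt_or_ge (Γ * √(gammaS S)) γ with h | h
  · rw [empiricalError_eq_one hP hA hΓ.le hfΓ hS h]
    have htest : testError D f ≤ 1 := measureReal_le_one
    have : 0 ≤ 2 * (Γ * √(gammaS S) / γ) * a := by positivity
    linarith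
  obtain ⟨j, hj, hj'⟩ := exists_nat_pow_near ((one_le_div hγ).2 h) one_lt_two
  have hρ : 0 < Γ / 2 ^ (j + 1) := by positivity
  have hργ : Γ / 2 ^ (j + 1) * √(gammaS S) ≤ γ := by
    rw [div_mul_eq_mul_div, div_le_iff₀ (by positivity), mul_comm γ]
    exact ((div_lt_iff₀ hγ).1 hj').le
  have hpow : 2 ^ (j + 1) * a ≤ 2 * (Γ * √(gammaS S) / γ) * a := by
    rw [pow_succ']
    gcongr
  calc testError D f ≤ ∫ z, rampLoss (Γ / 2 ^ (j + 1)) f z ∂D :=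
        testError_le_integral_rampLoss hf hsmul hρ.le
    _ ≤ (∑ i, rampLoss (Γ / 2 ^ (j + 1)) f (S i)) / (nP * nA) + (2 ^ (j + 1) * a + b) :=
        hdev (j + 1)
    _ ≤ empiricalError S γ f + (2 * (Γ * √(gammaS S) / γ) * a + b) := by
        gcongr
        exact sum_rampLoss_div_le_empiricalError hsmul hρ hγ hργ
    _ = empiricalError S γ f + 2 * (Γ * √(gammaS S) / γ) * a + b := by ring

end Errors

section Rates

theorem sqrt_div_le_two_div_rpow {l N : ℝ} (hN : 0 < N) (h : log 2 * l ≤ √N) :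
    √(l / N) ≤ 2 / N ^ (1 / 4 : ℝ) := by
  have hl : l ≤ 4 * √N := by
    nlinarith [log_two_gt_d9, sqrt_nonneg N]
  have hsq : (N ^ (1 / 4 : ℝ)) ^ 2 = √N := by
    rw [sqrt_eq_rpow, ← rpow_natCast, ← rpow_mul hN.le]
    norm_num
  refine sqrt_le_iff.2 ⟨by positivity, ?_⟩
  rw [div_pow, hsq, div_le_div_iff₀ hN (by positivity)]
  nlinarith [mul_self_sqrt hN.le, sqrt_nonneg N]

theorem sqrt_le_rpow_of_one_le {G : ℝ} (hG : 1 ≤ G) : √G ≤ G ^ (3 / 4 : ℝ) := by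
  rw [sqrt_eq_rpow]
  exact rpow_le_rpow_of_exponent_le hG (by norm_num)

theorem sqrt_log_div_le_c₁_div {γ δ N : ℝ} (hN : 0 ≤ N) :
    √(log (1 / δ) / N) ≤ c₁ γ δ / √N := by
  rw [sqrt_div' _ hN, c₁]
  gcongr
  exact le_add_of_nonneg_left (sqrt_nonneg _)

theorem margin_bound_le {Γ G γ δ p q l : ℝ} (hΓ : 0 ≤ Γ) (hG : 1 ≤ G) (hγ : 0 < γ) (hp : 0 < p)
    (hq : 0 < q) (hl : log 2 * l ≤ √(p * q)) :
    10 * (Γ * √G / γ * √(l / (p * q))) + √(log (1 / δ) / (p * q)) ≤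
      20 * (Γ * G ^ (3 / 4 : ℝ) / (p ^ (1 / 4 : ℝ) * q ^ (1 / 4 : ℝ) * γ)) +
        c₁ γ δ / √(p * q) := by
  calc 10 * (Γ * √G / γ * √(l / (p * q))) + √(log (1 / δ) / (p * q))
      ≤ 10 * (Γ * G ^ (3 / 4 : ℝ) / γ * (2 / (p * q) ^ (1 / 4 : ℝ))) + c₁ γ δ / √(p * q) := by
        gcongr
        · exact sqrt_le_rpow_of_one_le hG
        · exact sqrt_div_le_two_div_rpow (by positivity) hl
        · exact sqrt_log_div_le_c₁_div (by positivity)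
    _ = _ := by
        rw [mul_rpow hp.le hq.le]
        ring

end Rates

end AlgSel

end

theorem mainTheorem7_general {dP dA nP nA l : ℕ} {R : ℕ → ℝ}
    (D : Measure (AlgSel.LabeledInstance dP dA)) [IsProbabilityMeasure D] {δ : ℝ}
    (hP : 1 ≤ nP) (hA : 1 ≤ nA) (hl : 1 ≤ l) (hδ : 0 < δ) (hD : ∀ᵐ z ∂D, |AlgSel.label z| ≤ 1)
    (hΓ : 0 < AlgSel.gammaF l R) :
    Measure.pi (fun _ : Fin nP × Fin nA => D)
      {S | ¬ ∀ γ : ℝ, 0 < γ → ∀ f ∈ AlgSel.networkClass (Fin dP ⊕ Fin dA) l R,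
        AlgSel.testError D f ≤ AlgSel.empiricalError S γ f
          + (10 * (AlgSel.gammaF l R * √(AlgSel.gammaS S) / γ * √(l / (nP * nA)))
            + √(Real.log (1 / δ) / (nP * nA)))} ≤ ENNReal.ofReal δ := by
  rcases (AlgSel.networkClass (Fin dP ⊕ Fin dA) l R).eq_empty_or_nonempty with hF | ⟨f₀, hf₀⟩
  · simp [hF]
  have hR := AlgSel.nonneg_of_mem_networkClass hf₀
  have hcard : (Fintype.card (Fin nP × Fin nA) : ℝ) = nP * nA := by simp
  have : Nonempty (Fin nP × Fin nA) := ⟨⟨0, hP⟩, ⟨0, hA⟩⟩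
  have hdev := AlgSel.measure_exists_average_rampLoss_add_lt_integral_le (ι := Fin nP × Fin nA)
    hl hD hR hΓ hδ
  refine (measure_mono_ae ?_).trans hdev
  filter_upwards [AlgSel.ae_pi_forall hD] with S hS hbad
  by_contra hgood
  refine hbad fun γ hγ f hf => ?_
  have hdev_f (j : ℕ) := not_lt.1 fun h => hgood ⟨j, f, hf, h⟩
  simp only [hcard] at hdev_f
  have htest := AlgSel.testError_le_of_rampLoss_deviation hP hA
    (AlgSel.continuous_of_mem_networkClass hl hf)
    (fun c hc x => AlgSel.map_smul_of_mem_networkClass hl hf hc x) hΓ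
    (AlgSel.abs_le_of_mem_networkClass hl hf) hS (by positivity) (by positivity) hdev_f hγ
  linarith

theorem mainTheorem7 :
    ∃ K₁ K₂ : ℝ, 0 < K₁ ∧ 0 < K₂ ∧
      ∀ (dP dA nP nA l : ℕ) (R : ℕ → ℝ) (D : Measure (AlgSel.LabeledInstance dP dA)) (δ : ℝ),
        1 ≤ nP → 1 ≤ nA → 1 ≤ l → 0 < δ → δ < 1 →
        IsProbabilityMeasure D →
        (∀ᵐ z ∂D, AlgSel.label z = 1 ∨ AlgSel.label z = -1) →
        1 < AlgSel.gammaF l R →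
        Real.log 2 * (l : ℝ) ≤ √((nP : ℝ) * (nA : ℝ)) →
        -- the training sample is i.i.d. with law `D`; the failure event has probability at most `δ`
        Measure.pi (fun _ : Fin nP × Fin nA => D)
          {S | ¬ (1 < AlgSel.gammaS S →
            ∀ γ : ℝ, 0 < γ → ∀ f ∈ AlgSel.networkClass (Fin dP ⊕ Fin dA) l R,
              AlgSel.testError D f ≤ AlgSel.empiricalError S γ f
                + K₁ * (AlgSel.gammaF l R * AlgSel.gammaS S ^ (3 / 4 : ℝ)
                    / ((nP : ℝ) ^ (1 / 4 : ℝ) * (nA : ℝ) ^ (1 / 4 : ℝ) * γ))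
                + K₂ * (AlgSel.c₁ γ δ / √((nP : ℝ) * (nA : ℝ))))} ≤ ENNReal.ofReal δ := by
  refine ⟨20, 1, by norm_num, one_pos, ?_⟩
  intro dP dA nP nA l R D δ hP hA hl hδ _ _ hD hΓ hln
  refine (measure_mono ?_).trans (mainTheorem7_general D hP hA hl hδ
    (hD.mono fun z hz => by rcases hz with h | h <;> simp [h]) (one_pos.trans hΓ))
  refine fun S hbad hgood => hbad fun hG γ hγ f hf => (hgood γ hγ f hf).trans ?_
  rw [add_assoc, one_mul]
  exact add_le_add le_rfl (AlgSel.margin_bound_le (one_pos.trans hΓ).le hG.le hγ (by positivity)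
    (by positivity) hln)
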